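/- Let $\alpha>0$, $\alpha\neq 1$, and let $\mu$ be a $\sigma$-finite measure on a measurable space $\mathbb{X}$. All probability measures $P$ considered are absolutely continuous with respect to $\mu$ with density $p=dP/d\mu\in L^\alpha(\mu)$. Put $\rho=\alpha^{-1}-1$ and define the relative $\alpha$-entropy $$\mathscr{I}_\alpha(P,R)=\frac1\rho\log\bigl[\operatorname{sgn}(\rho)\,I_f(P',R')+1\bigr]\in[0,\infty],$$ where $P'$ has $\mu$-density $p'=p^\alpha/\int p^\alpha d\mu$ (likewise $R'$, $r'$), $f(u)=\operatorname{sgn}(\rho)(u^{1+\rho}-1)$ and $I_f(P',R')=\int r' f(p'/r')\,d\mu$, with $0\cdot f(0/0)=0$ and, for $a>0$, $0\cdot f(a/0)=\infty$ if $\rho>0$ and $0\cdot f(a/0)=0$ if $\rho<0$. Let $B(R,\infty)=\{P:\mathscr{I}_\alpha(P,R)<\infty\}$. A forward $\mathscr{I}_\alpha$-projection of $R$ on a set $\mathbb{E}$ of probability measures with $\mathbb{E}\cap B(R,\infty)\ne\emptyset$ is a $Q\in\mathbb{E}$ with $\mathscr{I}_\alpha(Q,R)=\inf_{P\in\mathbb{E}}\mathscr{I}_\alpha(P,R)$.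 Let $f_\gamma:\mathbb{X}\to\mathbb{R}$ $(\gamma\in\Gamma)$ be measurable, let $\mathbb{L}=\{P: f_\gamma\in L^1(P),\ \int f_\gamma\,dP=0\ \ \forall\gamma\in\Gamma\}$, and let $R$ be a probability measure with $\mu$-density $r$. Suppose that the linear span of $\{f_\gamma\}_{\gamma\in\Gamma}$ is $L^1(P)$-closed for every $P\in\mathbb{L}$ (this holds, for example, whenever $\Gamma$ is finite). Then $Q\in\mathbb{L}$ is the forward $\mathscr{I}_\alpha$-projection of $R$ on $\mathbb{L}$ if and only if there are a scalar $c\in\mathbb{R}$, a function $g$ in the linear span of $\{f_\gamma\}$ and a measurable set $N\subseteq\mathbb{X}$ such that the $\mu$-density $q$ of $Q$ satisfies, $\mu$-almost everywhere, $$q(x)^{\alpha-1}=c\,r(x)^{\alpha-1}+g(x)\quad (x\notin N),\qquad q(x)=0\quad (x\in N)$$ (with $0^{\alpha-1}=\infty$ if $\alpha<1$), and, for every $P\in\mathbb{L}\cap B(R,\infty)$, $$P(N)=0\ \text{ if }\alpha<1,\qquad c\int_N r^{\alpha-1}\,dP\le\int_{\mathbb{X}\setminus N} g\,dP\ \text{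 if }\alpha>1.$$ Moreover, for $\alpha>1$, every scalar $c$, every $g$ in the span, every measurable $N$ and every $P\in\mathbb{L}$, the last inequality is equivalent to $$\int_N\bigl(c\,r^{\alpha-1}+g\bigr)\,dP\le 0 .$$ -/

import Mathlib

open MeasureTheory
open scoped ENNReal

noncomputable section

namespace RelAlpha

variable {X : Type*} [MeasurableSpace X]

/-- The integral `∫ F dμ` of an extended-real function, as an extended real:
the integral of the positive part minus the integral of the negative part. -/
def extIntegral (μ : Measure X) (F : X → EReal) : EReal :=
  ((∫⁻ x, (F x).toENNReal ∂μ : ℝ≥0∞) : EReal) - ((∫⁻ x, (-F x).toENNReal ∂μ : ℝ≥0∞) : EReal)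

/-- The integrand `b * f (a / b)` of Csiszár's divergence, with
`f u = sgn ρ * (u ^ (1 + ρ) - 1)` and the conventions `0 * f (0 / 0) = 0` and, for `a > 0`,
`0 * f (a / 0) = ∞` if `ρ > 0` and `0 * f (a / 0) = 0` if `ρ < 0`. -/
def csiszarTerm (ρ : ℝ) (a b : ℝ≥0∞) : EReal :=
  if b = 0 then
    if a = 0 then 0 else if 0 < ρ then ⊤ else 0
  else
    ((b.toReal * (Real.sign ρ * ((a.toReal / b.toReal) ^ (1 + ρ) - 1)) : ℝ) : EReal)

/-- Csiszár's `f`-divergence `I_f(P, Q) = ∫ q f(p / q) dμ`, where `p` and `q` are the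
`μ`-densities of `P` and `Q`. -/
def csiszarDiv (μ : Measure X) (ρ : ℝ) (P Q : Measure X) : EReal :=
  extIntegral μ fun x => csiszarTerm ρ (P.rnDeriv μ x) (Q.rnDeriv μ x)

/-- The escort measure `P'`, with `μ`-density `p ^ α / ∫ p ^ α dμ`. -/
def escort (μ : Measure X) (α : ℝ) (P : Measure X) : Measure X :=
  μ.withDensity fun x => P.rnDeriv μ x ^ α / ∫⁻ y, P.rnDeriv μ y ^ α ∂μ

/-- The relative `α`-entropy `(1 / ρ) * log (sgn ρ * I_f(P', Q') + 1)` with `ρ = 1 / α - 1`.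
`ENNReal.log` is the logarithm with `log 0 = -∞` and `log ∞ = ∞`; its argument is
nonnegative for all probability measures in the scope of the definition. -/
def relEntropy (μ : Measure X) (α : ℝ) (P Q : Measure X) : EReal :=
  (((α⁻¹ - 1)⁻¹ : ℝ) : EReal) *
    ENNReal.log
      (((Real.sign (α⁻¹ - 1) : ℝ) : EReal) *
        csiszarDiv μ (α⁻¹ - 1) (escort μ α P) (escort μ α Q) + 1).toENNReal

/-- The standing assumption on probability measures: absolutely continuous with respect to `μ`,
with a density in `L^α(μ)`. -/
structure Admissible (μ : Measure X) (α : ℝ) (P : Measure X) : Prop where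
  isProb : IsProbabilityMeasure P
  ac : P ≪ μ
  memLp : MemLp (P.rnDeriv μ) (ENNReal.ofReal α) μ

/-- The set `B(R, ∞)` of probability measures at finite relative `α`-entropy from `R`. -/
def finiteBall (μ : Measure X) (α : ℝ) (R : Measure X) : Set (Measure X) :=
  {P | Admissible μ α P ∧ relEntropy μ α P R < ⊤}

/-- `Q` is a forward projection of `R` on the set `E`. -/
def IsForwardProjection (μ : Measure X) (α : ℝ) (E : Set (Measure X)) (R Q : Measure X) : Prop :=
  (∃ P ∈ E, relEntropy μ α P R < ⊤) ∧ Q ∈ E ∧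
    relEntropy μ α Q R = ⨅ P ∈ E, relEntropy μ α P R

/-- The linear family determined by the constraint functions `f γ`. -/
def linearFamily (μ : Measure X) (α : ℝ) {Γ : Type*} (f : Γ → X → ℝ) : Set (Measure X) :=
  {P | Admissible μ α P ∧ ∀ γ, Integrable (f γ) P ∧ ∫ x, f γ x ∂P = 0}

/-- The linear span of the constraint functions. -/
def constraintSpan {Γ : Type*} (f : Γ → X → ℝ) : Submodule ℝ (X → ℝ) :=
  Submodule.span ℝ (Set.range f)

/-- The span of the constraint functions is closed in `L¹(P)`. -/
def SpanClosedL1 {Γ : Type*} (f : Γ → X → ℝ) (P : Measure X) : Prop :=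
  IsClosed {h : Lp ℝ 1 P | ∃ g ∈ constraintSpan f, h =ᵐ[P] g}

/-- The inequality `c ∫_N r ^ (α - 1) dP ≤ ∫_{X \ N} g dP`, used for `α > 1`. -/
def SideIneq (μ : Measure X) (α : ℝ) (R : Measure X) (c : ℝ) (g : X → ℝ) (N : Set X)
    (P : Measure X) : Prop :=
  c * ∫ x in N, (R.rnDeriv μ x).toReal ^ (α - 1) ∂P ≤ ∫ x in Nᶜ, g x ∂P

/-- The `μ`-density `q` of `Q` has the power-law form with parameters `c`, `g`, `N` relative to
`R` and the set `E`. The equation between powers is read in the extended reals, so that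
`0 ^ (α - 1) = ∞` when `α < 1`. -/
structure HasPowerLaw (μ : Measure X) (α : ℝ) (E : Set (Measure X)) (R Q : Measure X)
    (c : ℝ) (g : X → ℝ) (N : Set X) : Prop where
  measurable_N : MeasurableSet N
  density_off : ∀ᵐ x ∂μ, x ∉ N →
    ((Q.rnDeriv μ x ^ (α - 1) : ℝ≥0∞) : EReal) =
      (c : EReal) * ((R.rnDeriv μ x ^ (α - 1) : ℝ≥0∞) : EReal) + (g x : EReal)
  density_on : ∀ᵐ x ∂μ, x ∈ N → Q.rnDeriv μ x = 0
  side_lt_one : α < 1 → ∀ P ∈ E ∩ finiteBall μ α R, P N = 0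
  side_one_lt : 1 < α → ∀ P ∈ E ∩ finiteBall μ α R, SideIneq μ α R c g N P

end RelAlpha

end

/-!
Put `ρ = 1/α - 1`, `S_Z(P) = ∫ z ^ (α - 1) dP` and `M(P) = ∫ p ^ α dμ = S_P(P)`. In the escort
densities the divergence becomes a ratio, and the relative entropy of `P` and `R` is
`(1/ρ) log (S_R(P) / (M(P) ^ (1/α) M(R) ^ (1 - 1/α)))`, where `S_R(P)` is linear in `P`.

Hölder's inequality compares `S_Q(P)` with `M(P) ^ (1/α) M(Q) ^ (1 - 1/α)`. Together with the
comparison of `Q` and `(1 - t) Q + t P` as `t → 0`, it turns minimality of `Q` into the variational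
inequality `S_R(Q) S_Q(P) ≤ S_R(P) M(Q)` for all `P` in the family, reversed if `α > 1`.

Testing this inequality on bounded reweightings of `Q` shows that every bounded function
annihilating all constraints in `L¹(Q)` also annihilates
`S_R(Q) q ^ (α - 1) - M(Q) r ^ (α - 1)`, which therefore lies in the closed span; this is the power
law with `c = M(Q) / S_R(Q)` and `N = {q = 0}`. Conversely, integrating the power law against `Q`
gives `M(Q) = c S_R(Q)` with `c > 0`, and integrating it against `P` recovers the variational
inequality.
-/

open MeasureTheory Filter
open scoped ENNReal Topology

noncomputable section

namespace RelAlpha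

variable {X : Type*} [MeasurableSpace X]

section Duality

variable {P : Measure X} [IsFiniteMeasure P]

theorem ae_abs_le_of_forall_abs_setIntegral_le {k : X → ℝ} {C : ℝ} (hk : Integrable k P)
    (h : ∀ s, MeasurableSet s → |∫ x in s, k x ∂P| ≤ C * P.real s) : ∀ᵐ x ∂P, |k x| ≤ C := by
  have hle : k ≤ᵐ[P] fun _ => C := by
    refine ae_le_of_forall_setIntegral_le hk (integrable_const _) fun s hs _ => ?_
    rw [setIntegral_const, smul_eq_mul, mul_comm]
    exact (le_abs_self _).trans (h s hs)
  have hge : (fun _ => -C) ≤ᵐ[P] k := by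
    refine ae_le_of_forall_setIntegral_le (integrable_const _) hk fun s hs _ => ?_
    rw [setIntegral_const, smul_eq_mul, mul_neg, mul_comm]
    exact neg_le_of_abs_le (h s hs)
  filter_upwards [hle, hge] with x hx hx' using abs_le.2 ⟨hx', hx⟩

theorem dual_L1_ext {φ ψ : Lp ℝ 1 P →L[ℝ] ℝ}
    (h : ∀ s (hs : MeasurableSet s), φ (indicatorConstLp 1 hs (measure_ne_top P s) 1) =
      ψ (indicatorConstLp 1 hs (measure_ne_top P s) 1)) : φ = ψ := by
  ext v
  induction v using Lp.induction ENNReal.one_ne_top with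
  | @indicatorConst c s hs hPs =>
    have hsmul : (Lp.simpleFunc.indicatorConst 1 hs hPs.ne c : Lp ℝ 1 P) =
        c • indicatorConstLp 1 hs hPs.ne (1 : ℝ) := by
      rw [Lp.simpleFunc.coe_indicatorConst, indicatorConstLp, indicatorConstLp,
        ← MemLp.toLp_const_smul]
      exact MemLp.toLp_congr _ _ (ae_of_all _ fun x => by simp [Set.indicator])
    rw [hsmul, map_smul, map_smul, h s hs]
  | add hf hg _ hφf hφg => rw [map_add, map_add, hφf, hφg]
  | isClosed => exact isClosed_eq φ.continuous ψ.continuous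

/-- Restricting `φ` to `L²(P)` makes Riesz representation available. -/
theorem exists_setIntegral_eq_of_dual_L1 (φ : Lp ℝ 1 P →L[ℝ] ℝ) :
    ∃ k : X → ℝ, Measurable k ∧ Integrable k P ∧ ∀ s (hs : MeasurableSet s),
      φ (indicatorConstLp 1 hs (measure_ne_top P s) 1) = ∫ x in s, k x ∂P := by
  let ι : Lp ℝ 2 P →L[ℝ] Lp ℝ 1 P :=
    (ContinuousLinearMap.mul ℝ ℝ).holderL P 2 2 1 (Lp.const 2 P 1)
  have hι : ∀ v : Lp ℝ 2 P, ι v =ᵐ[P] v := fun v => by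
    filter_upwards [(ContinuousLinearMap.mul ℝ ℝ).coeFn_holder (r := 1) (Lp.const 2 P (1 : ℝ)) v,
      Lp.coeFn_const 2 P (1 : ℝ)] with x hx hx1
    rw [hx1] at hx
    exact hx.trans (one_mul _)
  let k : Lp ℝ 2 P := (InnerProductSpace.toDual ℝ _).symm (φ ∘L ι)
  refine ⟨k, (Lp.stronglyMeasurable k).measurable,
    memLp_one_iff_integrable.1 ((Lp.memLp k).mono_exponent one_le_two), fun s hs => ?_⟩
  have hind : ι (indicatorConstLp 2 hs (measure_ne_top P s) 1) =
      indicatorConstLp 1 hs (measure_ne_top P s) 1 :=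
    Lp.ext ((hι _).trans (indicatorConstLp_coeFn.trans indicatorConstLp_coeFn.symm))
  rw [← hind, ← L2.inner_indicatorConstLp_one (𝕜 := ℝ), real_inner_comm,
    InnerProductSpace.toDual_symm_apply, ContinuousLinearMap.comp_apply]

theorem exists_bounded_integral_mul_eq_of_dual_L1 (φ : Lp ℝ 1 P →L[ℝ] ℝ) :
    ∃ k : X → ℝ, Measurable k ∧ (∀ x, |k x| ≤ ‖φ‖) ∧
      ∀ v : Lp ℝ 1 P, φ v = ∫ x, k x * v x ∂P := by
  obtain ⟨k₀, hk₀m, hk₀, hφ⟩ := exists_setIntegral_eq_of_dual_L1 φ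
  have hk₀_le : ∀ᵐ x ∂P, |k₀ x| ≤ ‖φ‖ := by
    refine ae_abs_le_of_forall_abs_setIntegral_le hk₀ fun s hs => ?_
    rw [← hφ s hs, ← Real.norm_eq_abs]
    refine (φ.le_opNorm _).trans_eq ?_
    rw [norm_indicatorConstLp one_ne_zero ENNReal.one_ne_top]
    simp
  let k : X → ℝ := fun x => max (-‖φ‖) (min (k₀ x) ‖φ‖)
  have hkm : Measurable k := measurable_const.max (hk₀m.min measurable_const)
  have hk_le : ∀ x, |k x| ≤ ‖φ‖ := fun x => abs_le.2
    ⟨le_max_left _ _, max_le (neg_le_self (norm_nonneg φ)) (min_le_right _ _)⟩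
  have hk : k =ᵐ[P] k₀ := by
    filter_upwards [hk₀_le] with x hx
    simp only [k, min_eq_left (abs_le.1 hx).2, max_eq_right (abs_le.1 hx).1]
  have hk_top : MemLp k ⊤ P := memLp_top_of_bound hkm.aestronglyMeasurable _ (ae_of_all _ hk_le)
  let ψ : Lp ℝ 1 P →L[ℝ] ℝ := (ContinuousLinearMap.mul ℝ ℝ).lpPairing P ⊤ 1 (hk_top.toLp k)
  have hψ : ∀ v : Lp ℝ 1 P, ψ v = ∫ x, k x * v x ∂P := fun v => by
    rw [ContinuousLinearMap.lpPairing_eq_integral]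
    refine integral_congr_ae ?_
    filter_upwards [hk_top.coeFn_toLp] with x hx
    rw [hx, ContinuousLinearMap.mul_apply']
  suffices φ = ψ from ⟨k, hkm, hk_le, fun v => by rw [this, hψ]⟩
  refine dual_L1_ext fun s hs => ?_
  rw [hφ s hs, hψ, ← integral_indicator hs]
  refine integral_congr_ae ?_
  filter_upwards [hk, indicatorConstLp_coeFn (p := 1) (hs := hs) (hμs := measure_ne_top P s)
    (c := (1 : ℝ))] with x hx hx1
  rw [hx1, hx]
  by_cases hxs : x ∈ s <;> simp [hxs]

end Duality

section Span

variable {Γ : Type*} {f : Γ → X → ℝ} {P : Measure X}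

theorem integrable_of_mem_constraintSpan (hf : ∀ γ, Integrable (f γ) P) {g : X → ℝ}
    (hg : g ∈ constraintSpan f) : Integrable g P := by
  induction hg using Submodule.span_induction with
  | mem g hg => obtain ⟨γ, rfl⟩ := hg; exact hf γ
  | zero => exact integrable_zero _ _ _
  | add g k _ _ hg hk => exact hg.add hk
  | smul a g _ hg => exact hg.smul a

theorem integral_eq_zero_of_mem_constraintSpan (hf : ∀ γ, Integrable (f γ) P)
    (hf₀ : ∀ γ, ∫ x, f γ x ∂P = 0) {g : X → ℝ} (hg : g ∈ constraintSpan f) :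
    ∫ x, g x ∂P = 0 := by
  induction hg using Submodule.span_induction with
  | mem g hg => obtain ⟨γ, rfl⟩ := hg; exact hf₀ γ
  | zero => simp
  | add g k hg hk hg₀ hk₀ =>
    simp only [Pi.add_apply]
    rw [integral_add (integrable_of_mem_constraintSpan hf hg)
      (integrable_of_mem_constraintSpan hf hk), hg₀, hk₀, add_zero]
  | smul a g _ hg₀ => simp only [Pi.smul_apply]; rw [integral_smul, hg₀, smul_zero]

variable (f P) in
/-- The set occurring in `SpanClosedL1`, the elements of `L¹(P)` represented by a function in the
constraint span, as a submodule. -/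
def spanL1 : Submodule ℝ (Lp ℝ 1 P) where
  carrier := {h : Lp ℝ 1 P | ∃ g ∈ constraintSpan f, h =ᵐ[P] g}
  zero_mem' := ⟨0, Submodule.zero_mem _, Lp.coeFn_zero ℝ 1 P⟩
  add_mem' := by
    rintro a b ⟨g, hg, hag⟩ ⟨k, hk, hbk⟩
    exact ⟨g + k, Submodule.add_mem _ hg hk, (Lp.coeFn_add a b).trans (hag.add hbk)⟩
  smul_mem' := by
    rintro c a ⟨g, hg, hag⟩
    exact ⟨c • g, Submodule.smul_mem _ c hg, (Lp.coeFn_smul c a).trans (hag.const_smul c)⟩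

theorem spanClosedL1_of_finite [Finite Γ] (hf : ∀ γ, Integrable (f γ) P) : SpanClosedL1 f P := by
  have hint : ∀ g ∈ constraintSpan f, Integrable g P :=
    fun g => integrable_of_mem_constraintSpan hf
  let Φ : constraintSpan f →ₗ[ℝ] Lp ℝ 1 P :=
    { toFun := fun g => (hint g.1 g.2).toL1 g.1
      map_add' := fun _ _ => rfl
      map_smul' := fun _ _ => rfl }
  have hspan : spanL1 f P = Φ.range := by
    ext h
    constructor
    · rintro ⟨g, hg, hhg⟩
      exact ⟨⟨g, hg⟩, Lp.ext ((hint g hg).coeFn_toL1.trans hhg.symm)⟩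
    · rintro ⟨g, rfl⟩
      exact ⟨g.1, g.2, (hint g.1 g.2).coeFn_toL1⟩
  have : FiniteDimensional ℝ (constraintSpan f) :=
    FiniteDimensional.span_of_finite ℝ (Set.finite_range f)
  have hclosed : IsClosed (Φ.range : Set (Lp ℝ 1 P)) := Submodule.closed_of_finiteDimensional _
  rwa [← hspan] at hclosed

theorem exists_dual_spanL1_eq_zero_of_notMem (hcl : SpanClosedL1 f P) {v : Lp ℝ 1 P}
    (hv : v ∉ spanL1 f P) :
    ∃ φ : Lp ℝ 1 P →L[ℝ] ℝ, (∀ a ∈ spanL1 f P, φ a = 0) ∧ 0 < φ v := by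
  obtain ⟨φ, s, hφ, hs⟩ := geometric_hahn_banach_closed_point (spanL1 f P).convex hcl hv
  refine ⟨φ, fun a ha => ?_, ?_⟩
  · by_contra hne
    have hlt := hφ ((s / φ a) • a) (Submodule.smul_mem _ _ ha)
    rw [map_smul, smul_eq_mul, div_mul_cancel₀ _ hne] at hlt
    exact lt_irrefl _ hlt
  · have hs_pos := hφ 0 (Submodule.zero_mem _)
    rw [map_zero] at hs_pos
    exact hs_pos.trans hs

theorem exists_bounded_annihilator_of_forall_not_ae_eq [IsFiniteMeasure P]
    (hf : ∀ γ, Integrable (f γ) P) (hcl : SpanClosedL1 f P) {u : X → ℝ} (hu : Integrable u P)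
    (hu_span : ∀ g ∈ constraintSpan f, ¬ u =ᵐ[P] g) :
    ∃ (k : X → ℝ) (K : ℝ), Measurable k ∧ (∀ x, |k x| ≤ K) ∧
      (∀ γ, ∫ x, k x * f γ x ∂P = 0) ∧ 0 < ∫ x, k x * u x ∂P := by
  have hv : hu.toL1 u ∉ spanL1 f P := by
    rintro ⟨g, hg, hug⟩
    exact hu_span g hg (hu.coeFn_toL1.symm.trans hug)
  obtain ⟨φ, hφ, hφu⟩ := exists_dual_spanL1_eq_zero_of_notMem hcl hv
  obtain ⟨k, hkm, hk_le, hφk⟩ := exists_bounded_integral_mul_eq_of_dual_L1 φ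
  have hφ_toL1 : ∀ {v : X → ℝ} (hv : Integrable v P), φ (hv.toL1 v) = ∫ x, k x * v x ∂P := by
    intro v hv
    rw [hφk]
    refine integral_congr_ae ?_
    filter_upwards [hv.coeFn_toL1] with x hx
    rw [hx]
  refine ⟨k, ‖φ‖, hkm, hk_le, fun γ => ?_, by rwa [← hφ_toL1 hu]⟩
  rw [← hφ_toL1 (hf γ)]
  exact hφ _ ⟨f γ, Submodule.subset_span ⟨γ, rfl⟩, (hf γ).coeFn_toL1⟩

/-- A bounded annihilator `k` of the constraints yields the admissible reweighting
`1 + (k - ∫ k) / (2 K + 1)`, where `|k| ≤ K`. -/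
theorem exists_mem_constraintSpan_of_reweighting [IsProbabilityMeasure P]
    (hf : ∀ γ, Integrable (f γ) P) (hf₀ : ∀ γ, ∫ x, f γ x ∂P = 0) (hcl : SpanClosedL1 f P)
    {u : X → ℝ} (hu : Integrable u P) (hu₀ : ∫ x, u x ∂P = 0)
    (H : ∀ w : X → ℝ, Measurable w → (∀ x, 0 ≤ w x) → (∀ x, w x ≤ 2) → ∫ x, w x ∂P = 1 →
      (∀ γ, ∫ x, w x * f γ x ∂P = 0) → ∫ x, w x * u x ∂P ≤ 0) :
    ∃ g ∈ constraintSpan f, u =ᵐ[P] g := by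
  by_contra! hu_span
  obtain ⟨k, K, hkm, hkK, hkf, hku⟩ :=
    exists_bounded_annihilator_of_forall_not_ae_eq hf hcl hu hu_span
  have hk : Integrable k P := .of_bound hkm.aestronglyMeasurable K (ae_of_all _ hkK)
  set m := ∫ x, k x ∂P with hm
  have hmK : |m| ≤ K := by
    simpa using norm_integral_le_of_norm_le_const (f := k) (ae_of_all P hkK)
  have hK : 0 < 2 * K + 1 := by linarith [(abs_nonneg m).trans hmK]
  let w : X → ℝ := fun x => 1 + (k x - m) / (2 * K + 1)
  have hw : ∀ x, |(k x - m) / (2 * K + 1)| ≤ 1 := fun x => by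
    rw [abs_div, abs_of_pos hK, div_le_one hK]
    linarith [abs_sub (k x) m, hkK x]
  have hw_mul : ∀ v : X → ℝ, Integrable v P → ∫ x, v x ∂P = 0 →
      ∫ x, w x * v x ∂P = (∫ x, k x * v x ∂P) / (2 * K + 1) := fun v hv hv₀ => by
    have hkv : Integrable (fun x => k x * v x) P :=
      hv.bdd_mul hkm.aestronglyMeasurable (ae_of_all _ hkK)
    have hexpand : ∀ x, w x * v x =
        (1 - m / (2 * K + 1)) * v x + k x * v x / (2 * K + 1) := fun x => by
      simp only [w]; ring
    simp only [hexpand]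
    rw [integral_add (hv.const_mul _) (hkv.div_const _), integral_const_mul, hv₀, mul_zero,
      zero_add, integral_div]
  have hw_int : ∫ x, w x ∂P = 1 := by
    simp only [w]
    have hkw : Integrable (fun x => (k x - m) / (2 * K + 1)) P :=
      (hk.sub (integrable_const m)).div_const _
    rw [integral_add (integrable_const _) hkw, integral_div, integral_sub hk (integrable_const m)]
    simp [← hm]
  have hwu := H w (by fun_prop) (fun x => by linarith [(abs_le.1 (hw x)).1])
    (fun x => by linarith [(abs_le.1 (hw x)).2]) hw_int
    (fun γ => by rw [hw_mul _ (hf γ) (hf₀ γ), hkf, zero_div])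
  rw [hw_mul u hu hu₀] at hwu
  exact hwu.not_gt (div_pos hku hK)

end Span

section Csiszar

variable {μ : Measure X} {ρ : ℝ}

theorem sign_mul_csiszarTerm (hρ : ρ ≠ 0) (hρ₁ : -1 < ρ) {a b : ℝ≥0∞} (ha : a ≠ ⊤) (hb : b ≠ ⊤) :
    (Real.sign ρ : EReal) * csiszarTerm ρ a b =
      ((a ^ (1 + ρ) * b ^ (-ρ) : ℝ≥0∞) : EReal) - (b : EReal) := by
  have hρ₁' : 0 < 1 + ρ := by linarith
  rcases eq_or_ne b 0 with rfl | hb₀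
  · rcases eq_or_ne a 0 with rfl | ha₀
    · simp [csiszarTerm, hρ₁']
    · have ha_pow : a ^ (1 + ρ) ≠ 0 := by simp [ha₀, hρ₁', hρ₁'.not_gt]
      rcases hρ.lt_or_gt with hneg | hpos
      · simp [csiszarTerm, hneg, hneg.not_gt]
      · simp [csiszarTerm, ha₀, hpos, Real.sign_of_pos, ENNReal.zero_rpow_of_neg,
          ENNReal.mul_top ha_pow]
  · lift a to NNReal using ha
    lift b to NNReal using hb
    have hb_pos : 0 < b := by simpa [pos_iff_ne_zero] using hb₀
    have hsign : Real.sign ρ * Real.sign ρ = 1 := by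
      rcases hρ.lt_or_gt with hneg | hpos
      · simp [Real.sign_of_neg hneg]
      · simp [Real.sign_of_pos hpos]
    have hb_rpow : ((b : ℝ≥0∞)) ^ (-ρ) = ((b ^ (-ρ) : NNReal) : ℝ≥0∞) :=
      (ENNReal.coe_rpow_of_ne_zero hb_pos.ne' _).symm
    have hb_pos' : (0 : ℝ) < b := hb_pos
    rw [csiszarTerm, if_neg hb₀, ← ENNReal.coe_rpow_of_nonneg _ hρ₁'.le, hb_rpow,
      ← ENNReal.coe_mul, EReal.coe_nnreal_eq_coe_real, EReal.coe_nnreal_eq_coe_real,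
      ← EReal.coe_mul, ← EReal.coe_sub, EReal.coe_eq_coe_iff, mul_left_comm,
      ← mul_assoc _ _ (_ - _), hsign, one_mul, NNReal.coe_mul, NNReal.coe_rpow, NNReal.coe_rpow,
      ENNReal.coe_toReal, ENNReal.coe_toReal, Real.div_rpow a.coe_nonneg hb_pos'.le,
      Real.rpow_add hb_pos', Real.rpow_one, Real.rpow_neg hb_pos'.le]
    have := (Real.rpow_pos_of_pos hb_pos' ρ).ne'
    field_simp

theorem toENNReal_neg_coe_sub_coe (a : ℝ≥0∞) {b : ℝ≥0∞} (hb : b ≠ ⊤) :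
    (-((a : EReal) - (b : EReal))).toENNReal = b - a := by
  rw [EReal.neg_sub (.inl (EReal.coe_ennreal_ne_bot _))
    (.inr (EReal.coe_ennreal_eq_top_iff.not.2 hb)), add_comm, ← sub_eq_add_neg,
    EReal.toENNReal_sub (EReal.coe_ennreal_nonneg _), EReal.toENNReal_coe, EReal.toENNReal_coe]

theorem extIntegral_coe_sub_coe {τ b : X → ℝ≥0∞} (hτ : Measurable τ) (hb : Measurable b)
    (hb_top : ∫⁻ x, b x ∂μ ≠ ⊤) :
    extIntegral μ (fun x => (τ x : EReal) - (b x : EReal)) =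
      ((∫⁻ x, τ x ∂μ : ℝ≥0∞) : EReal) - ((∫⁻ x, b x ∂μ : ℝ≥0∞) : EReal) := by
  have hpos : ∫⁻ x, ((τ x : EReal) - (b x : EReal)).toENNReal ∂μ = ∫⁻ x, (τ x - b x) ∂μ := by
    simp only [EReal.toENNReal_sub (EReal.coe_ennreal_nonneg _), EReal.toENNReal_coe]
  have hneg : ∫⁻ x, (-((τ x : EReal) - (b x : EReal))).toENNReal ∂μ = ∫⁻ x, (b x - τ x) ∂μ := by
    refine lintegral_congr_ae ?_
    filter_upwards [ae_lt_top hb hb_top] with x hx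
    exact toENNReal_neg_coe_sub_coe _ hx.ne
  have hneg_top : ∫⁻ x, (b x - τ x) ∂μ ≠ ⊤ :=
    ne_top_of_le_ne_top hb_top (lintegral_mono fun _ => tsub_le_self)
  have hbalance : ∫⁻ x, (τ x - b x) ∂μ + ∫⁻ x, b x ∂μ = ∫⁻ x, (b x - τ x) ∂μ + ∫⁻ x, τ x ∂μ := by
    rw [← lintegral_add_right _ hb, ← lintegral_add_right _ hτ]
    simp only [tsub_add_eq_max, max_comm]
  rw [extIntegral, hpos, hneg]
  generalize ∫⁻ x, (τ x - b x) ∂μ = A at *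
  generalize ∫⁻ x, τ x ∂μ = T at *
  lift ∫⁻ x, b x ∂μ to NNReal using hb_top with B
  lift ∫⁻ x, (b x - τ x) ∂μ to NNReal using hneg_top with C
  replace hbalance := congrArg (fun z : ℝ≥0∞ => (z : EReal)) hbalance
  simp only [EReal.coe_ennreal_add, EReal.coe_nnreal_eq_coe_real] at hbalance ⊢
  calc (A : EReal) - (C : ℝ) = A + (B : ℝ) - (B : ℝ) - (C : ℝ) := by
        rw [EReal.add_sub_cancel_right]
    _ = (C : ℝ) + T - (C : ℝ) - (B : ℝ) := by
        rw [hbalance]; simp only [sub_eq_add_neg, add_right_comm]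
    _ = T - (B : ℝ) := by rw [EReal.add_sub_cancel_left]

theorem sign_mul_extIntegral {F : X → EReal}
    (hF : ∫⁻ x, (-((Real.sign ρ : EReal) * F x)).toENNReal ∂μ ≠ ⊤) :
    (Real.sign ρ : EReal) * extIntegral μ F =
      extIntegral μ fun x => (Real.sign ρ : EReal) * F x := by
  rcases lt_trichotomy ρ 0 with hneg | rfl | hpos
  · simp only [Real.sign_of_neg hneg, EReal.coe_neg, EReal.coe_one, neg_mul, one_mul,
      neg_neg] at hF ⊢
    rw [extIntegral, extIntegral, EReal.neg_sub (.inl (EReal.coe_ennreal_ne_bot _))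
      (.inl (EReal.coe_ennreal_eq_top_iff.not.2 hF)), add_comm, ← sub_eq_add_neg]
    simp only [neg_neg]
  · simp [extIntegral]
  · simp [Real.sign_of_pos hpos]

theorem sign_mul_csiszarDiv (hρ : ρ ≠ 0) (hρ₁ : -1 < ρ) (P R : Measure X) [SigmaFinite P]
    [IsFiniteMeasure R] :
    (Real.sign ρ : EReal) * csiszarDiv μ ρ P R =
      ((∫⁻ x, P.rnDeriv μ x ^ (1 + ρ) * R.rnDeriv μ x ^ (-ρ) ∂μ : ℝ≥0∞) : EReal) -
        ((∫⁻ x, R.rnDeriv μ x ∂μ : ℝ≥0∞) : EReal) := by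
  have hR_top : ∫⁻ x, R.rnDeriv μ x ∂μ ≠ ⊤ := (Measure.lintegral_rnDeriv_lt_top R μ).ne
  have hterm : ∀ᵐ x ∂μ, (Real.sign ρ : EReal) * csiszarTerm ρ (P.rnDeriv μ x) (R.rnDeriv μ x) =
      ((P.rnDeriv μ x ^ (1 + ρ) * R.rnDeriv μ x ^ (-ρ) : ℝ≥0∞) : EReal) -
        (R.rnDeriv μ x : EReal) := by
    filter_upwards [P.rnDeriv_ne_top μ, R.rnDeriv_ne_top μ] with x hP hR
    exact sign_mul_csiszarTerm hρ hρ₁ hP hR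
  have hneg_top : ∫⁻ x, (-((Real.sign ρ : EReal) *
      csiszarTerm ρ (P.rnDeriv μ x) (R.rnDeriv μ x))).toENNReal ∂μ ≠ ⊤ := by
    refine ne_top_of_le_ne_top hR_top (lintegral_mono_ae ?_)
    filter_upwards [hterm, R.rnDeriv_ne_top μ] with x hx hR
    rw [hx, toENNReal_neg_coe_sub_coe _ hR]
    exact tsub_le_self
  rw [csiszarDiv, sign_mul_extIntegral hneg_top, ← extIntegral_coe_sub_coe (by fun_prop)
    (Measure.measurable_rnDeriv R μ) hR_top, extIntegral, extIntegral,
    lintegral_congr_ae (hterm.mono fun x hx => congrArg EReal.toENNReal hx),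
    lintegral_congr_ae (hterm.mono fun x hx => congrArg (fun z => (-z).toENNReal) hx)]

end Csiszar

/-- The integral `∫ p ^ α dμ`, where `p` is the `μ`-density of `P`. -/
def powMass (μ : Measure X) (α : ℝ) (P : Measure X) : ℝ≥0∞ :=
  ∫⁻ x, P.rnDeriv μ x ^ α ∂μ

/-- The integral `∫ z ^ (α - 1) dP`, where `z` is the `μ`-density of `Z`. It is linear in `P`, and
`crossMass μ α P P = powMass μ α P` when `P` is absolutely continuous. -/
def crossMass (μ : Measure X) (α : ℝ) (Z P : Measure X) : ℝ≥0∞ :=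
  ∫⁻ x, Z.rnDeriv μ x ^ (α - 1) ∂P

section Mass

variable {μ : Measure X} {α : ℝ} {P : Measure X}

theorem mul_rpow_sub_one (hα : 0 < α) {x : ℝ≥0∞} (hx : x ≠ ⊤) : x * x ^ (α - 1) = x ^ α := by
  rcases eq_or_ne x 0 with rfl | hx₀
  · simp [hα]
  · rw [ENNReal.rpow_sub _ _ hx₀ hx, ENNReal.rpow_one, ENNReal.mul_div_cancel hx₀ hx]

theorem Admissible.powMass_ne_top (hα : 0 < α) (hP : Admissible μ α P) : powMass μ α P ≠ ⊤ := by
  have hlt := lintegral_rpow_enorm_lt_top_of_eLpNorm_lt_top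
    (ENNReal.ofReal_pos.2 hα).ne' ENNReal.ofReal_ne_top hP.memLp.2
  simpa only [ENNReal.toReal_ofReal hα.le, enorm_eq_self, powMass] using hlt.ne

theorem admissible_of_powMass_ne_top (hα : 0 < α) (hP : IsProbabilityMeasure P) (hac : P ≪ μ)
    (hpow : powMass μ α P ≠ ⊤) : Admissible μ α P := by
  refine ⟨hP, hac, (P.measurable_rnDeriv μ).aestronglyMeasurable, ?_⟩
  rw [eLpNorm_lt_top_iff_lintegral_rpow_enorm_lt_top (ENNReal.ofReal_pos.2 hα).ne'
    ENNReal.ofReal_ne_top, ENNReal.toReal_ofReal hα.le]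
  simpa only [enorm_eq_self, powMass] using hpow.lt_top

variable [SigmaFinite μ]

theorem crossMass_eq_lintegral_rnDeriv_mul [SigmaFinite P] (hac : P ≪ μ) (Z : Measure X) :
    crossMass μ α Z P = ∫⁻ x, P.rnDeriv μ x * Z.rnDeriv μ x ^ (α - 1) ∂μ :=
  (lintegral_rnDeriv_mul hac ((Z.measurable_rnDeriv μ).pow_const _).aemeasurable).symm

theorem crossMass_self [SigmaFinite P] (hα : 0 < α) (hac : P ≪ μ) :
    crossMass μ α P P = powMass μ α P := by
  rw [crossMass_eq_lintegral_rnDeriv_mul hac, powMass]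
  refine lintegral_congr_ae ?_
  filter_upwards [P.rnDeriv_ne_top μ] with x hx using mul_rpow_sub_one hα hx

theorem Admissible.powMass_ne_zero (hα : 0 < α) (hP : Admissible μ α P) : powMass μ α P ≠ 0 := by
  have := hP.isProb
  intro h
  rw [powMass, lintegral_eq_zero_iff ((P.measurable_rnDeriv μ).pow_const α)] at h
  have hp : P.rnDeriv μ =ᵐ[μ] 0 := by
    filter_upwards [h] with x hx
    simpa [hα, hα.not_gt] using hx
  have hmass := Measure.lintegral_rnDeriv hP.ac
  rw [lintegral_congr_ae hp] at hmass
  simp at hmass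

theorem Admissible.powMass_rpow_ne_zero (hα : 0 < α) (hP : Admissible μ α P) (s : ℝ) :
    powMass μ α P ^ s ≠ 0 :=
  (ENNReal.rpow_pos (pos_iff_ne_zero.2 (hP.powMass_ne_zero hα)) (hP.powMass_ne_top hα)).ne'

theorem Admissible.powMass_rpow_ne_top (hα : 0 < α) (hP : Admissible μ α P) (s : ℝ) :
    powMass μ α P ^ s ≠ ⊤ :=
  ENNReal.rpow_ne_top_of_ne_zero (hP.powMass_ne_zero hα) (hP.powMass_ne_top hα)

end Mass

section Entropy

variable {μ : Measure X} [SigmaFinite μ] {α : ℝ} {P R : Measure X}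

theorem rnDeriv_escort (P : Measure X) :
    (escort μ α P).rnDeriv μ =ᵐ[μ] fun x => P.rnDeriv μ x ^ α / powMass μ α P :=
  Measure.rnDeriv_withDensity μ (((P.measurable_rnDeriv μ).pow_const α).div_const _)

theorem Admissible.isProbabilityMeasure_escort (hα : 0 < α) (hP : Admissible μ α P) :
    IsProbabilityMeasure (escort μ α P) := by
  refine ⟨?_⟩
  rw [escort, withDensity_apply _ MeasurableSet.univ, Measure.restrict_univ]
  simp only [div_eq_mul_inv]
  rw [lintegral_mul_const _ ((P.measurable_rnDeriv μ).pow_const α)]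
  exact ENNReal.mul_inv_cancel (hP.powMass_ne_zero hα) (hP.powMass_ne_top hα)

theorem lintegral_rnDeriv_escort_rpow_mul (hα : 0 < α) (hP : Admissible μ α P)
    (hR : Admissible μ α R) :
    ∫⁻ x, (escort μ α P).rnDeriv μ x ^ α⁻¹ * (escort μ α R).rnDeriv μ x ^ (1 - α⁻¹) ∂μ =
      crossMass μ α R P / (powMass μ α P ^ α⁻¹ * powMass μ α R ^ (1 - α⁻¹)) := by
  have := hP.isProb
  have := hR.isProb
  have hP₀ := hP.powMass_rpow_ne_zero hα α⁻¹
  have hR₀ := hR.powMass_rpow_ne_zero hα (1 - α⁻¹)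
  rw [crossMass_eq_lintegral_rnDeriv_mul hP.ac, div_eq_mul_inv,
    ← lintegral_mul_const' _ _ (ENNReal.inv_ne_top.2 (mul_ne_zero hP₀ hR₀))]
  refine lintegral_congr_ae ?_
  filter_upwards [rnDeriv_escort (μ := μ) (α := α) P, rnDeriv_escort (μ := μ) (α := α) R,
    R.rnDeriv_ne_top μ] with x hPx hRx hrx
  rw [hPx, hRx, ENNReal.div_rpow_of_nonneg _ _ (inv_pos.2 hα).le, ENNReal.rpow_rpow_inv hα.ne',
    div_eq_mul_inv (_ ^ α), ENNReal.mul_rpow_of_ne_top (ENNReal.rpow_ne_top_of_nonneg hα.le hrx)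
      (ENNReal.inv_ne_top.2 (hR.powMass_ne_zero hα)), ← ENNReal.rpow_mul, ENNReal.inv_rpow,
    ENNReal.mul_inv (.inl hP₀) (.inr hR₀), mul_one_sub, mul_inv_cancel₀ hα.ne', div_eq_mul_inv]
  ring

theorem relEntropy_eq (hα : 0 < α) (hα₁ : α ≠ 1) (hP : Admissible μ α P)
    (hR : Admissible μ α R) :
    relEntropy μ α P R = (((α⁻¹ - 1)⁻¹ : ℝ) : EReal) *
      ENNReal.log (crossMass μ α R P / (powMass μ α P ^ α⁻¹ * powMass μ α R ^ (1 - α⁻¹))) := by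
  have := hP.isProbabilityMeasure_escort hα
  have := hR.isProbabilityMeasure_escort hα
  have hρ : α⁻¹ - 1 ≠ 0 := sub_ne_zero.2 (inv_ne_one.2 hα₁)
  have hρ₁ : -1 < α⁻¹ - 1 := by linarith [inv_pos.2 hα]
  have hac : escort μ α R ≪ μ := withDensity_absolutelyContinuous _ _
  rw [relEntropy, sign_mul_csiszarDiv hρ hρ₁, Measure.lintegral_rnDeriv hac, measure_univ,
    add_sub_cancel, neg_sub, lintegral_rnDeriv_escort_rpow_mul hα hP hR, EReal.coe_ennreal_one,
    ← EReal.coe_one, EReal.sub_add_cancel, EReal.toENNReal_coe]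

end Entropy

section EntropyOrder

theorem coe_mul_le_coe_mul_iff_of_pos {c : ℝ} (hc : 0 < c) {x y : EReal} :
    (c : EReal) * x ≤ c * y ↔ x ≤ y := by
  have hcancel : ∀ z : EReal, ((c⁻¹ : ℝ) : EReal) * (c * z) = z := fun z => by
    rw [← mul_assoc, ← EReal.coe_mul, inv_mul_cancel₀ hc.ne', EReal.coe_one, one_mul]
  refine ⟨fun h => ?_, fun h => mul_le_mul_of_nonneg_left h (EReal.coe_nonneg.2 hc.le)⟩
  rw [← hcancel x, ← hcancel y]
  exact mul_le_mul_of_nonneg_left h (EReal.coe_nonneg.2 (inv_pos.2 hc).le)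

theorem coe_mul_le_coe_mul_iff_of_neg {c : ℝ} (hc : c < 0) {x y : EReal} :
    (c : EReal) * x ≤ c * y ↔ y ≤ x := by
  have hneg : ∀ z : EReal, (c : EReal) * z = -(((-c : ℝ) : EReal) * z) := fun z => by
    rw [EReal.coe_neg, neg_mul, neg_neg]
  rw [hneg, hneg, EReal.neg_le_neg_iff, coe_mul_le_coe_mul_iff_of_pos (neg_pos.2 hc)]

theorem coe_mul_lt_top_iff_of_pos {c : ℝ} (hc : 0 < c) {x : EReal} :
    (c : EReal) * x < ⊤ ↔ x < ⊤ := by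
  rw [← EReal.coe_mul_top_of_pos hc, ← not_le, coe_mul_le_coe_mul_iff_of_pos hc, not_le,
    EReal.coe_mul_top_of_pos hc]

theorem coe_mul_lt_top_iff_of_neg {c : ℝ} (hc : c < 0) {x : EReal} :
    (c : EReal) * x < ⊤ ↔ ⊥ < x := by
  rw [← EReal.coe_mul_bot_of_neg hc, ← not_le, coe_mul_le_coe_mul_iff_of_neg hc, not_le]

theorem div_mul_le_div_mul_iff {a b c d k : ℝ≥0∞} (hc : c ≠ 0) (hc' : c ≠ ⊤) (hd : d ≠ 0)
    (hd' : d ≠ ⊤) (hk : k ≠ 0) (hk' : k ≠ ⊤) :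
    a / (c * k) ≤ b / (d * k) ↔ a * d ≤ b * c := by
  rw [ENNReal.div_le_iff (mul_ne_zero hc hk) (ENNReal.mul_ne_top hc' hk'),
    ← ENNReal.mul_div_right_comm,
    ENNReal.le_div_iff_mul_le (.inl (mul_ne_zero hd hk)) (.inl (ENNReal.mul_ne_top hd' hk')),
    ← mul_assoc, ← mul_assoc, ENNReal.mul_le_mul_iff_left hk hk']

theorem inv_inv_sub_one_pos {α : ℝ} (hα : 0 < α) (hα₁ : α < 1) : 0 < (α⁻¹ - 1)⁻¹ :=
  inv_pos.2 (sub_pos.2 ((one_lt_inv₀ hα).2 hα₁))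

theorem inv_inv_sub_one_neg {α : ℝ} (hα₁ : 1 < α) : (α⁻¹ - 1)⁻¹ < 0 :=
  inv_lt_zero.2 (sub_neg.2 (inv_lt_one_of_one_lt₀ hα₁))

variable {μ : Measure X} [SigmaFinite μ] {α : ℝ} {P Q R : Measure X}

theorem relEntropy_le_iff_of_lt_one (hα : 0 < α) (hα₁ : α < 1) (hP : Admissible μ α P)
    (hQ : Admissible μ α Q) (hR : Admissible μ α R) :
    relEntropy μ α Q R ≤ relEntropy μ α P R ↔
      crossMass μ α R Q * powMass μ α P ^ α⁻¹ ≤ crossMass μ α R P * powMass μ α Q ^ α⁻¹ := by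
  rw [relEntropy_eq hα hα₁.ne hP hR, relEntropy_eq hα hα₁.ne hQ hR,
    coe_mul_le_coe_mul_iff_of_pos (inv_inv_sub_one_pos hα hα₁), ENNReal.log_le_log_iff,
    div_mul_le_div_mul_iff] <;>
  simp only [Admissible.powMass_rpow_ne_zero hα, Admissible.powMass_rpow_ne_top hα, ne_eq,
    not_false_eq_true, *]

theorem relEntropy_le_iff_of_one_lt (hα₁ : 1 < α) (hP : Admissible μ α P)
    (hQ : Admissible μ α Q) (hR : Admissible μ α R) :
    relEntropy μ α Q R ≤ relEntropy μ α P R ↔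
      crossMass μ α R P * powMass μ α Q ^ α⁻¹ ≤ crossMass μ α R Q * powMass μ α P ^ α⁻¹ := by
  have hα := zero_lt_one.trans hα₁
  rw [relEntropy_eq hα hα₁.ne' hP hR, relEntropy_eq hα hα₁.ne' hQ hR,
    coe_mul_le_coe_mul_iff_of_neg (inv_inv_sub_one_neg hα₁), ENNReal.log_le_log_iff,
    div_mul_le_div_mul_iff] <;>
  simp only [Admissible.powMass_rpow_ne_zero hα, Admissible.powMass_rpow_ne_top hα, ne_eq,
    not_false_eq_true, *]

theorem relEntropy_lt_top_iff_of_lt_one (hα : 0 < α) (hα₁ : α < 1) (hP : Admissible μ α P)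
    (hR : Admissible μ α R) : relEntropy μ α P R < ⊤ ↔ crossMass μ α R P ≠ ⊤ := by
  rw [relEntropy_eq hα hα₁.ne hP hR, coe_mul_lt_top_iff_of_pos (inv_inv_sub_one_pos hα hα₁),
    lt_top_iff_ne_top, Ne, ENNReal.log_eq_top_iff, ENNReal.div_eq_top]
  simp [ENNReal.mul_eq_top, Admissible.powMass_rpow_ne_zero hα,
    Admissible.powMass_rpow_ne_top hα, *]

theorem relEntropy_lt_top_iff_of_one_lt (hα₁ : 1 < α) (hP : Admissible μ α P)
    (hR : Admissible μ α R) : relEntropy μ α P R < ⊤ ↔ crossMass μ α R P ≠ 0 := by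
  have hα := zero_lt_one.trans hα₁
  rw [relEntropy_eq hα hα₁.ne' hP hR, coe_mul_lt_top_iff_of_neg (inv_inv_sub_one_neg hα₁),
    bot_lt_iff_ne_bot, Ne, ENNReal.log_eq_bot_iff, ENNReal.div_eq_zero_iff]
  simp [ENNReal.mul_eq_top, Admissible.powMass_rpow_ne_zero hα,
    Admissible.powMass_rpow_ne_top hα, *]

end EntropyOrder

section Hoelder

variable {μ : Measure X} {α : ℝ} {P Q : Measure X}

theorem ae_ne_zero_of_crossMass_ne_top (hα₁ : α < 1) (h : crossMass μ α Q P ≠ ⊤) :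
    ∀ᵐ x ∂P, Q.rnDeriv μ x ≠ 0 := by
  filter_upwards [ae_lt_top ((Q.measurable_rnDeriv μ).pow_const (α - 1)) h] with x hx hq
  rw [hq, ENNReal.zero_rpow_of_neg (sub_neg.2 hα₁)] at hx
  exact lt_irrefl _ hx

variable [SigmaFinite μ]

theorem crossMass_le_powMass_rpow_mul (hα₁ : 1 < α) [SigmaFinite P] (hac : P ≪ μ)
    (Q : Measure X) :
    crossMass μ α Q P ≤ powMass μ α P ^ α⁻¹ * powMass μ α Q ^ (1 - α⁻¹) := by
  have hα := zero_lt_one.trans hα₁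
  have hprod : ∀ x, P.rnDeriv μ x * Q.rnDeriv μ x ^ (α - 1) =
      (P.rnDeriv μ x ^ α) ^ α⁻¹ * (Q.rnDeriv μ x ^ α) ^ (1 - α⁻¹) := fun x => by
    rw [ENNReal.rpow_rpow_inv hα.ne', ← ENNReal.rpow_mul, mul_one_sub, mul_inv_cancel₀ hα.ne']
  rw [crossMass_eq_lintegral_rnDeriv_mul hac, lintegral_congr hprod]
  exact ENNReal.lintegral_mul_norm_pow_le (by fun_prop) (by fun_prop) (inv_pos.2 hα).le
    (sub_nonneg.2 (inv_le_one_of_one_le₀ hα₁.le)) (add_sub_cancel _ _)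

theorem Admissible.crossMass_ne_top (hα₁ : 1 < α) (hP : Admissible μ α P)
    (hQ : Admissible μ α Q) : crossMass μ α Q P ≠ ⊤ := by
  have hα := zero_lt_one.trans hα₁
  have := hP.isProb
  exact ne_top_of_le_ne_top
    (ENNReal.mul_ne_top (hP.powMass_rpow_ne_top hα _) (hQ.powMass_rpow_ne_top hα _))
    (crossMass_le_powMass_rpow_mul hα₁ hP.ac Q)

theorem ae_iff_forall_ae_rnDeriv_ne_zero [SigmaFinite P] (hac : P ≪ μ) {p : X → Prop} :
    (∀ᵐ x ∂P, p x) ↔ ∀ᵐ x ∂μ, P.rnDeriv μ x ≠ 0 → p x := by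
  conv_lhs => rw [← Measure.withDensity_rnDeriv_eq P μ hac]
  exact ae_withDensity_iff (P.measurable_rnDeriv μ)

theorem powMass_le_crossMass_rpow_mul (hα : 0 < α) (hα₁ : α < 1) [SigmaFinite P] (hac : P ≪ μ)
    [SigmaFinite Q] (hPQ : ∀ᵐ x ∂P, Q.rnDeriv μ x ≠ 0) :
    powMass μ α P ≤ crossMass μ α Q P ^ α * powMass μ α Q ^ (1 - α) := by
  have hprod : ∀ᵐ x ∂μ, P.rnDeriv μ x ^ α =
      (P.rnDeriv μ x * Q.rnDeriv μ x ^ (α - 1)) ^ α * (Q.rnDeriv μ x ^ α) ^ (1 - α) := by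
    filter_upwards [(ae_iff_forall_ae_rnDeriv_ne_zero hac).1 hPQ, Q.rnDeriv_ne_top μ] with x hx hq
    rcases eq_or_ne (P.rnDeriv μ x) 0 with hp | hp
    · simp [hp, hα]
    · rw [ENNReal.mul_rpow_of_nonneg _ _ hα.le, ← ENNReal.rpow_mul, ← ENNReal.rpow_mul, mul_assoc,
        ← ENNReal.rpow_add _ _ (hx hp) hq, show (α - 1) * α + α * (1 - α) = 0 by ring,
        ENNReal.rpow_zero, mul_one]
  rw [crossMass_eq_lintegral_rnDeriv_mul hac, powMass, lintegral_congr_ae hprod]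
  exact ENNReal.lintegral_mul_norm_pow_le (by fun_prop) (by fun_prop) hα.le
    (sub_nonneg.2 hα₁.le) (add_sub_cancel _ _)

theorem powMass_rpow_mul_le_crossMass (hα : 0 < α) (hα₁ : α < 1) (hP : Admissible μ α P)
    (hQ : Admissible μ α Q) :
    powMass μ α P ^ α⁻¹ * powMass μ α Q ^ (1 - α⁻¹) ≤ crossMass μ α Q P := by
  have := hP.isProb
  have := hQ.isProb
  rcases eq_or_ne (crossMass μ α Q P) ⊤ with htop | htop
  · exact htop ▸ le_top
  calc powMass μ α P ^ α⁻¹ * powMass μ α Q ^ (1 - α⁻¹)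
      ≤ (crossMass μ α Q P ^ α * powMass μ α Q ^ (1 - α)) ^ α⁻¹ * powMass μ α Q ^ (1 - α⁻¹) := by
        gcongr
        exact powMass_le_crossMass_rpow_mul hα hα₁ hP.ac (ae_ne_zero_of_crossMass_ne_top hα₁ htop)
    _ = crossMass μ α Q P := by
        rw [ENNReal.mul_rpow_of_nonneg _ _ (inv_pos.2 hα).le, ENNReal.rpow_rpow_inv hα.ne',
          ← ENNReal.rpow_mul, mul_assoc, ← ENNReal.rpow_add _ _ (hQ.powMass_ne_zero hα)
            (hQ.powMass_ne_top hα), show (1 - α) * α⁻¹ + (1 - α⁻¹) = 0 by field_simp; ring,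
          ENNReal.rpow_zero, mul_one]

theorem Admissible.powMass_rpow_inv_mul_rpow (hα : 0 < α) (hP : Admissible μ α P) :
    powMass μ α P ^ α⁻¹ * powMass μ α P ^ (1 - α⁻¹) = powMass μ α P := by
  rw [← ENNReal.rpow_add _ _ (hP.powMass_ne_zero hα) (hP.powMass_ne_top hα), add_sub_cancel,
    ENNReal.rpow_one]

end Hoelder

section Mixture

/-- The mixture `(1 - t) Q + t P` of two measures. The weight is extended nonnegative, so that
`1 - t` truncates unless `t ≤ 1`. -/
def mix (t : ℝ≥0∞) (Q P : Measure X) : Measure X :=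
  (1 - t) • Q + t • P

theorem rpow_one_sub_mul_add_mul_le {t : ℝ≥0∞} (ht : t ≤ 1) {s : ℝ} (hs : 0 ≤ s) (q p : ℝ≥0∞) :
    ((1 - t) * q + t * p) ^ s ≤ q ^ s + p ^ s := by
  have hmax : (1 - t) * q + t * p ≤ max q p :=
    calc (1 - t) * q + t * p ≤ (1 - t) * max q p + t * max q p := by
          gcongr
          exacts [le_max_left _ _, le_max_right _ _]
      _ = max q p := by rw [← add_mul, tsub_add_cancel_of_le ht, one_mul]
  refine (ENNReal.rpow_le_rpow hmax hs).trans ?_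
  rcases max_choice q p with h | h <;> rw [h]
  exacts [le_self_add, le_add_self]

theorem tendsto_rpow_one_sub_mul_add_mul (s : ℝ) (q : ℝ≥0∞) {p : ℝ≥0∞} (hp : p ≠ ⊤) :
    Tendsto (fun t : ℝ≥0∞ => ((1 - t) * q + t * p) ^ s) (𝓝[>] 0) (𝓝 (q ^ s)) := by
  have hid : Tendsto (fun t : ℝ≥0∞ => t) (𝓝[>] 0) (𝓝 0) := nhdsWithin_le_nhds
  have hsub : Tendsto (fun t : ℝ≥0∞ => 1 - t) (𝓝[>] 0) (𝓝 1) := by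
    simpa only [tsub_zero] using
      ENNReal.Tendsto.sub tendsto_const_nhds hid (.inl ENNReal.one_ne_top)
  have hbase := (ENNReal.Tendsto.mul_const (b := q) hsub (.inl one_ne_zero)).add
    (ENNReal.Tendsto.mul_const (b := p) hid (.inr hp))
  rw [one_mul, zero_mul, add_zero] at hbase
  exact (ENNReal.continuous_rpow_const.tendsto q).comp hbase

variable {μ : Measure X} {α : ℝ} {t : ℝ≥0∞} {P Q : Measure X}

theorem isProbabilityMeasure_mix (ht : t ≤ 1) (hQ : IsProbabilityMeasure Q)
    (hP : IsProbabilityMeasure P) : IsProbabilityMeasure (mix t Q P) :=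
  ⟨by simp [mix, tsub_add_cancel_of_le ht]⟩

theorem crossMass_mix (t : ℝ≥0∞) (Z Q P : Measure X) :
    crossMass μ α Z (mix t Q P) = (1 - t) * crossMass μ α Z Q + t * crossMass μ α Z P := by
  simp only [crossMass, mix, lintegral_add_measure, lintegral_smul_measure, smul_eq_mul]

theorem integrable_mix (ht : t ≤ 1) {v : X → ℝ} (hQ : Integrable v Q) (hP : Integrable v P) :
    Integrable v (mix t Q P) :=
  (hQ.smul_measure (ne_top_of_le_ne_top ENNReal.one_ne_top tsub_le_self)).add_measure
    (hP.smul_measure (ne_top_of_le_ne_top ENNReal.one_ne_top ht))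

theorem integral_mix (ht : t ≤ 1) {v : X → ℝ} (hQ : Integrable v Q) (hP : Integrable v P) :
    ∫ x, v x ∂(mix t Q P) = (1 - t).toReal * ∫ x, v x ∂Q + t.toReal * ∫ x, v x ∂P := by
  rw [mix, integral_add_measure
    (hQ.smul_measure (ne_top_of_le_ne_top ENNReal.one_ne_top tsub_le_self))
    (hP.smul_measure (ne_top_of_le_ne_top ENNReal.one_ne_top ht)), integral_smul_measure,
    integral_smul_measure, smul_eq_mul, smul_eq_mul]

variable [SigmaFinite μ]

theorem rnDeriv_mix [IsFiniteMeasure Q] [IsFiniteMeasure P] (ht : t ≤ 1) :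
    (mix t Q P).rnDeriv μ =ᵐ[μ] fun x => (1 - t) * Q.rnDeriv μ x + t * P.rnDeriv μ x := by
  have ht₁ : t ≠ ⊤ := ne_top_of_le_ne_top ENNReal.one_ne_top ht
  have ht₂ : 1 - t ≠ ⊤ := ne_top_of_le_ne_top ENNReal.one_ne_top tsub_le_self
  have := Measure.smul_finite Q ht₂
  have := Measure.smul_finite P ht₁
  filter_upwards [Measure.rnDeriv_add' ((1 - t) • Q) (t • P) μ,
    Measure.rnDeriv_smul_left_of_ne_top' Q μ ht₂,
    Measure.rnDeriv_smul_left_of_ne_top' P μ ht₁] with x h h₁ h₂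
  rw [mix, h, Pi.add_apply, h₁, h₂, Pi.smul_apply, Pi.smul_apply, smul_eq_mul, smul_eq_mul]

theorem crossMass_mix_left [IsFiniteMeasure Q] [IsFiniteMeasure P] (ht : t ≤ 1) {S : Measure X}
    (hS : S ≪ μ) :
    crossMass μ α (mix t Q P) S =
      ∫⁻ x, ((1 - t) * Q.rnDeriv μ x + t * P.rnDeriv μ x) ^ (α - 1) ∂S := by
  refine lintegral_congr_ae (hS.ae_le ?_)
  filter_upwards [rnDeriv_mix (μ := μ) (Q := Q) (P := P) ht] with x hx
  rw [hx]

theorem Admissible.mix (hα : 0 < α) (ht : t ≤ 1) (hQ : Admissible μ α Q)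
    (hP : Admissible μ α P) : Admissible μ α (mix t Q P) := by
  have := hQ.isProb
  have := hP.isProb
  refine admissible_of_powMass_ne_top hα (isProbabilityMeasure_mix ht hQ.isProb hP.isProb) ?_ ?_
  · exact (hQ.ac.smul_left _).add_left (hP.ac.smul_left _)
  · rw [powMass]
    refine ne_top_of_le_ne_top (ENNReal.add_ne_top.2
      ⟨hQ.powMass_ne_top hα, hP.powMass_ne_top hα⟩) ?_
    rw [powMass, powMass, ← lintegral_add_left ((Q.measurable_rnDeriv μ).pow_const α)]
    refine lintegral_mono_ae ?_
    filter_upwards [rnDeriv_mix (μ := μ) (Q := Q) (P := P) ht] with x hx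
    rw [hx]
    exact rpow_one_sub_mul_add_mul_le ht hα.le _ _

theorem mix_mem_linearFamily (hα : 0 < α) (ht : t ≤ 1) {Γ : Type*} {f : Γ → X → ℝ}
    (hQ : Q ∈ linearFamily μ α f) (hP : P ∈ linearFamily μ α f) :
    mix t Q P ∈ linearFamily μ α f := by
  refine ⟨hQ.1.mix hα ht hP.1, fun γ => ⟨integrable_mix ht (hQ.2 γ).1 (hP.2 γ).1, ?_⟩⟩
  rw [integral_mix ht (hQ.2 γ).1 (hP.2 γ).1, (hQ.2 γ).2, (hP.2 γ).2, mul_zero, mul_zero, add_zero]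

theorem powMass_mix (hα : 0 < α) (ht : t ≤ 1) (hQ : Admissible μ α Q) (hP : Admissible μ α P) :
    powMass μ α (mix t Q P) = (1 - t) * crossMass μ α (mix t Q P) Q +
      t * crossMass μ α (mix t Q P) P := by
  have hadm := hQ.mix hα ht hP
  have := hadm.isProb
  rw [← crossMass_self hα hadm.ac, crossMass_mix]

theorem crossMass_le_liminf_crossMass_mix [IsFiniteMeasure Q] [IsFiniteMeasure P] (hac : P ≪ μ) :
    crossMass μ α Q P ≤ liminf (fun t => crossMass μ α (mix t Q P) P) (𝓝[>] 0) :=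
  calc crossMass μ α Q P
      = ∫⁻ x, liminf (fun t : ℝ≥0∞ => ((1 - t) * Q.rnDeriv μ x + t * P.rnDeriv μ x) ^ (α - 1))
          (𝓝[>] 0) ∂P := by
        refine lintegral_congr_ae (hac.ae_le ?_)
        filter_upwards [P.rnDeriv_ne_top μ] with x hx
        exact (tendsto_rpow_one_sub_mul_add_mul _ _ hx).liminf_eq.symm
    _ ≤ liminf (fun t : ℝ≥0∞ =>
          ∫⁻ x, ((1 - t) * Q.rnDeriv μ x + t * P.rnDeriv μ x) ^ (α - 1) ∂P) (𝓝[>] 0) :=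
        lintegral_liminf_le fun t => by fun_prop
    _ = liminf (fun t => crossMass μ α (mix t Q P) P) (𝓝[>] 0) := by
        refine liminf_congr ?_
        filter_upwards [Ioc_mem_nhdsGT zero_lt_one] with t ht
        exact (crossMass_mix_left ht.2 hac).symm

theorem tendsto_crossMass_mix (hα₁ : 1 < α) (hQ : Admissible μ α Q) (hP : Admissible μ α P) :
    Tendsto (fun t => crossMass μ α (mix t Q P) P) (𝓝[>] 0) (𝓝 (crossMass μ α Q P)) := by
  have := hQ.isProb
  have := hP.isProb
  have hdom : Tendsto (fun t : ℝ≥0∞ =>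
      ∫⁻ x, ((1 - t) * Q.rnDeriv μ x + t * P.rnDeriv μ x) ^ (α - 1) ∂P)
      (𝓝[>] 0) (𝓝 (crossMass μ α Q P)) := by
    refine tendsto_lintegral_filter_of_dominated_convergence
      (fun x => Q.rnDeriv μ x ^ (α - 1) + P.rnDeriv μ x ^ (α - 1))
      (.of_forall fun t => by fun_prop) ?_ ?_ (hP.ac.ae_le ?_)
    · filter_upwards [Ioc_mem_nhdsGT zero_lt_one] with t ht
      exact ae_of_all _ fun x => rpow_one_sub_mul_add_mul_le ht.2 (sub_nonneg.2 hα₁.le) _ _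
    · rw [lintegral_add_left ((Q.measurable_rnDeriv μ).pow_const _)]
      exact ENNReal.add_ne_top.2 ⟨hP.crossMass_ne_top hα₁ hQ, hP.crossMass_ne_top hα₁ hP⟩
    · filter_upwards [P.rnDeriv_ne_top μ] with x hx
      exact tendsto_rpow_one_sub_mul_add_mul _ _ hx
  refine hdom.congr' ?_
  filter_upwards [Ioc_mem_nhdsGT zero_lt_one] with t ht
  exact (crossMass_mix_left ht.2 hP.ac).symm

theorem crossMass_mix_self_le (hα : 0 < α) (hα₁ : α < 1) (ht : t ≤ 1) (hQ : Admissible μ α Q)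
    [IsFiniteMeasure P] : crossMass μ α (mix t Q P) Q ≤ (1 - t) ^ (α - 1) * powMass μ α Q := by
  have := hQ.isProb
  rw [crossMass_mix_left ht hQ.ac, ← crossMass_self hα hQ.ac, crossMass,
    ← lintegral_const_mul _ ((Q.measurable_rnDeriv μ).pow_const _)]
  refine lintegral_mono_ae (hQ.ac.ae_le ?_)
  filter_upwards [Q.rnDeriv_ne_top μ] with x hx
  rw [← ENNReal.mul_rpow_of_ne_top (ne_top_of_le_ne_top ENNReal.one_ne_top tsub_le_self) hx,
    ← neg_sub 1 α, ENNReal.rpow_neg, ENNReal.rpow_neg, ENNReal.inv_le_inv]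
  exact ENNReal.rpow_le_rpow le_self_add (sub_nonneg.2 hα₁.le)

theorem le_crossMass_mix_self (hα₁ : 1 < α) (ht : t ≤ 1) (hQ : Admissible μ α Q)
    [IsFiniteMeasure P] : (1 - t) ^ (α - 1) * powMass μ α Q ≤ crossMass μ α (mix t Q P) Q := by
  have := hQ.isProb
  rw [crossMass_mix_left ht hQ.ac, ← crossMass_self (zero_lt_one.trans hα₁) hQ.ac, crossMass,
    ← lintegral_const_mul _ ((Q.measurable_rnDeriv μ).pow_const _)]
  refine lintegral_mono fun x => ?_
  rw [← ENNReal.mul_rpow_of_nonneg _ _ (sub_nonneg.2 hα₁.le)]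
  exact ENNReal.rpow_le_rpow le_self_add (sub_nonneg.2 hα₁.le)

theorem tendsto_one_sub_rpow_mul (s : ℝ) (a : ℝ≥0∞) :
    Tendsto (fun t : ℝ≥0∞ => (1 - t) ^ s * a) (𝓝[>] 0) (𝓝 a) := by
  have h := ENNReal.Tendsto.mul_const (b := a)
    (tendsto_rpow_one_sub_mul_add_mul s 1 ENNReal.zero_ne_top)
    (.inl (by rw [ENNReal.one_rpow]; exact one_ne_zero))
  simpa only [mul_one, mul_zero, add_zero, ENNReal.one_rpow, one_mul] using h

end Mixture

section VariationalInequality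

variable {μ : Measure X} {α : ℝ} {P Q R : Measure X}

theorem isForwardProjection_iff {E : Set (Measure X)} (hQ : Q ∈ E) :
    IsForwardProjection μ α E R Q ↔ relEntropy μ α Q R < ⊤ ∧
      ∀ P ∈ E, relEntropy μ α Q R ≤ relEntropy μ α P R := by
  constructor
  · rintro ⟨⟨P, hP, hPfin⟩, -, hmin⟩
    have hle : ∀ P ∈ E, relEntropy μ α Q R ≤ relEntropy μ α P R :=
      fun P hP => hmin.le.trans (iInf₂_le P hP)
    exact ⟨(hle P hP).trans_lt hPfin, hle⟩
  · rintro ⟨hfin, hle⟩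
    exact ⟨⟨Q, hQ, hfin⟩, hQ, le_antisymm (le_iInf₂ hle) (iInf₂_le Q hQ)⟩

variable [SigmaFinite μ]

theorem crossMass_mul_powMass_le_of_relEntropy_le (hα : 0 < α) (hα₁ : α < 1)
    (hP : Admissible μ α P) (hQ : Admissible μ α Q) (hR : Admissible μ α R)
    (hle : relEntropy μ α Q R ≤ relEntropy μ α P R) :
    crossMass μ α R Q * powMass μ α P ≤ crossMass μ α R P * crossMass μ α P Q :=
  calc crossMass μ α R Q * powMass μ α P
      = crossMass μ α R Q * powMass μ α P ^ α⁻¹ * powMass μ α P ^ (1 - α⁻¹) := by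
        rw [mul_assoc, hP.powMass_rpow_inv_mul_rpow hα]
    _ ≤ crossMass μ α R P * powMass μ α Q ^ α⁻¹ * powMass μ α P ^ (1 - α⁻¹) :=
        mul_le_mul_left ((relEntropy_le_iff_of_lt_one hα hα₁ hP hQ hR).1 hle) _
    _ ≤ crossMass μ α R P * crossMass μ α P Q := by
        rw [mul_assoc]
        gcongr
        exact powMass_rpow_mul_le_crossMass hα hα₁ hQ hP

theorem crossMass_mul_crossMass_le_of_relEntropy_le (hα₁ : 1 < α)
    (hP : Admissible μ α P) (hQ : Admissible μ α Q) (hR : Admissible μ α R)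
    (hle : relEntropy μ α Q R ≤ relEntropy μ α P R) :
    crossMass μ α R P * crossMass μ α P Q ≤ crossMass μ α R Q * powMass μ α P := by
  have := hQ.isProb
  calc crossMass μ α R P * crossMass μ α P Q
      ≤ crossMass μ α R P * powMass μ α Q ^ α⁻¹ * powMass μ α P ^ (1 - α⁻¹) := by
        rw [mul_assoc]
        gcongr
        exact crossMass_le_powMass_rpow_mul hα₁ hQ.ac P
    _ ≤ crossMass μ α R Q * powMass μ α P ^ α⁻¹ * powMass μ α P ^ (1 - α⁻¹) :=
        mul_le_mul_left ((relEntropy_le_iff_of_one_lt hα₁ hP hQ hR).1 hle) _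
    _ = crossMass μ α R Q * powMass μ α P := by
        rw [mul_assoc, hP.powMass_rpow_inv_mul_rpow (zero_lt_one.trans hα₁)]

theorem relEntropy_le_of_variation_of_lt_one (hα : 0 < α) (hα₁ : α < 1)
    (hP : Admissible μ α P) (hQ : Admissible μ α Q) (hR : Admissible μ α R)
    (hvar : crossMass μ α R Q * crossMass μ α Q P ≤ crossMass μ α R P * powMass μ α Q) :
    relEntropy μ α Q R ≤ relEntropy μ α P R := by
  rw [relEntropy_le_iff_of_lt_one hα hα₁ hP hQ hR, ← ENNReal.mul_le_mul_iff_left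
    (hQ.powMass_rpow_ne_zero hα (1 - α⁻¹)) (hQ.powMass_rpow_ne_top hα _), mul_assoc, mul_assoc,
    hQ.powMass_rpow_inv_mul_rpow hα]
  refine le_trans ?_ hvar
  gcongr
  exact powMass_rpow_mul_le_crossMass hα hα₁ hP hQ

theorem relEntropy_le_of_variation_of_one_lt (hα₁ : 1 < α)
    (hP : Admissible μ α P) (hQ : Admissible μ α Q) (hR : Admissible μ α R)
    (hvar : crossMass μ α R P * powMass μ α Q ≤ crossMass μ α R Q * crossMass μ α Q P) :
    relEntropy μ α Q R ≤ relEntropy μ α P R := by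
  have hα := zero_lt_one.trans hα₁
  have := hP.isProb
  rw [relEntropy_le_iff_of_one_lt hα₁ hP hQ hR, ← ENNReal.mul_le_mul_iff_left
    (hQ.powMass_rpow_ne_zero hα (1 - α⁻¹)) (hQ.powMass_rpow_ne_top hα _), mul_assoc, mul_assoc,
    hQ.powMass_rpow_inv_mul_rpow hα]
  refine hvar.trans ?_
  gcongr
  exact crossMass_le_powMass_rpow_mul hα₁ hP.ac Q

theorem mul_le_mul_of_mul_mix_le_mix_mul {s t a b A B : ℝ≥0∞} (ht : t ≠ 0) (ht' : t ≠ ⊤)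
    (hs : s ≠ ⊤) (ha : a ≠ ⊤) (hA : A ≠ ⊤) (h : a * (s * A + t * B) ≤ (s * a + t * b) * A) :
    a * B ≤ b * A := by
  have hfin : s * (a * A) ≠ ⊤ := ENNReal.mul_ne_top hs (ENNReal.mul_ne_top ha hA)
  have hle : s * (a * A) + t * (a * B) ≤ s * (a * A) + t * (b * A) := by
    convert h using 1 <;> ring
  exact (ENNReal.mul_le_mul_iff_right ht ht').1 ((ENNReal.add_le_add_iff_left hfin).1 hle)

theorem crossMass_mul_crossMass_le_of_forall_mix (hα : 0 < α) (hα₁ : α < 1)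
    (hP : Admissible μ α P) (hQ : Admissible μ α Q) (hR : Admissible μ α R)
    (hRQ : crossMass μ α R Q ≠ ⊤)
    (hle : ∀ t ∈ Set.Ioo (0 : ℝ≥0∞) 1, relEntropy μ α Q R ≤ relEntropy μ α (mix t Q P) R) :
    crossMass μ α R Q * crossMass μ α Q P ≤ crossMass μ α R P * powMass μ α Q := by
  have := hP.isProb
  have := hQ.isProb
  have hmix : ∀ᶠ t in 𝓝[>] (0 : ℝ≥0∞), crossMass μ α R Q * crossMass μ α (mix t Q P) P ≤
      crossMass μ α R P * ((1 - t) ^ (α - 1) * powMass μ α Q) := by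
    filter_upwards [Ioo_mem_nhdsGT zero_lt_one] with t ht
    have hA := crossMass_mix_self_le (P := P) hα hα₁ ht.2.le hQ
    have hA' : (1 - t) ^ (α - 1) * powMass μ α Q ≠ ⊤ := ENNReal.mul_ne_top
      (ENNReal.rpow_ne_top_of_ne_zero (tsub_pos_of_lt ht.2).ne'
        (ENNReal.sub_ne_top ENNReal.one_ne_top)) (hQ.powMass_ne_top hα)
    have hopt := crossMass_mul_powMass_le_of_relEntropy_le hα hα₁ (hQ.mix hα ht.2.le hP) hQ hR
      (hle t ht)
    rw [powMass_mix hα ht.2.le hQ hP, crossMass_mix] at hopt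
    exact (mul_le_mul_of_mul_mix_le_mix_mul ht.1.ne' ht.2.ne_top
      (ENNReal.sub_ne_top ENNReal.one_ne_top) hRQ (ne_top_of_le_ne_top hA' hA) hopt).trans
      (by gcongr)
  calc crossMass μ α R Q * crossMass μ α Q P
      ≤ crossMass μ α R Q * liminf (fun t => crossMass μ α (mix t Q P) P) (𝓝[>] 0) := by
        gcongr
        exact crossMass_le_liminf_crossMass_mix hP.ac
    _ = liminf (fun t => crossMass μ α R Q * crossMass μ α (mix t Q P) P) (𝓝[>] 0) :=
        (ENNReal.liminf_const_mul_of_ne_top hRQ).symm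
    _ ≤ liminf (fun t => crossMass μ α R P * ((1 - t) ^ (α - 1) * powMass μ α Q)) (𝓝[>] 0) :=
        liminf_le_liminf hmix
    _ = crossMass μ α R P * powMass μ α Q :=
        (ENNReal.Tendsto.const_mul (tendsto_one_sub_rpow_mul _ _)
          (.inl (hQ.powMass_ne_zero hα))).liminf_eq

theorem crossMass_mul_powMass_le_of_forall_mix (hα₁ : 1 < α)
    (hP : Admissible μ α P) (hQ : Admissible μ α Q) (hR : Admissible μ α R)
    (hle : ∀ t ∈ Set.Ioo (0 : ℝ≥0∞) 1, relEntropy μ α Q R ≤ relEntropy μ α (mix t Q P) R) :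
    crossMass μ α R P * powMass μ α Q ≤ crossMass μ α R Q * crossMass μ α Q P := by
  have hα := zero_lt_one.trans hα₁
  have := hP.isProb
  have := hQ.isProb
  refine le_of_tendsto_of_tendsto
    (ENNReal.Tendsto.const_mul (tendsto_one_sub_rpow_mul (α - 1) _)
      (.inl (hQ.powMass_ne_zero hα)))
    (ENNReal.Tendsto.const_mul (tendsto_crossMass_mix hα₁ hQ hP)
      (.inr (hQ.crossMass_ne_top hα₁ hR))) ?_
  filter_upwards [Ioo_mem_nhdsGT zero_lt_one] with t ht
  have hadm := hQ.mix hα ht.2.le hP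
  have hopt := crossMass_mul_crossMass_le_of_relEntropy_le hα₁ hadm hQ hR (hle t ht)
  rw [powMass_mix hα ht.2.le hQ hP, crossMass_mix] at hopt
  have hcancel : crossMass μ α R P * crossMass μ α (mix t Q P) Q ≤
      crossMass μ α R Q * crossMass μ α (mix t Q P) P := by
    rw [mul_comm (_ + _), mul_comm (crossMass μ α R Q)] at hopt
    rw [mul_comm (crossMass μ α R P), mul_comm (crossMass μ α R Q)]
    exact mul_le_mul_of_mul_mix_le_mix_mul ht.1.ne' ht.2.ne_top
      (ENNReal.sub_ne_top ENNReal.one_ne_top) (hQ.crossMass_ne_top hα₁ hadm)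
      (hQ.crossMass_ne_top hα₁ hR) hopt
  refine le_trans ?_ hcancel
  gcongr
  exact le_crossMass_mix_self hα₁ ht.2.le hQ

end VariationalInequality

section PowerLaw

theorem coe_eq_coe_mul_add_coe_iff {u v : ℝ≥0∞} (hu : u ≠ ⊤) (hv : v ≠ ⊤) {c g : ℝ} :
    (u : EReal) = (c : EReal) * (v : EReal) + (g : EReal) ↔ u.toReal = c * v.toReal + g := by
  rw [← EReal.coe_ennreal_toReal hu, ← EReal.coe_ennreal_toReal hv, ← EReal.coe_mul,
    ← EReal.coe_add, EReal.coe_eq_coe_iff]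

theorem add_ofReal_neg_mul_add_ofReal_neg_eq {u v : ℝ≥0∞} {c g : ℝ}
    (h : (u : EReal) = (c : EReal) * (v : EReal) + (g : EReal)) :
    u + ENNReal.ofReal (-c) * v + ENNReal.ofReal (-g) =
      ENNReal.ofReal c * v + ENNReal.ofReal g := by
  induction v using ENNReal.recTopCoe with
  | top =>
    rw [EReal.coe_ennreal_top] at h
    rcases lt_trichotomy c 0 with hc | rfl | hc
    · rw [EReal.coe_mul_top_of_neg hc, EReal.bot_add] at h
      exact absurd h (EReal.coe_ennreal_ne_bot u)
    · obtain rfl : u = ENNReal.ofReal g := by simpa using congrArg EReal.toENNReal h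
      have hg : 0 ≤ g := by simpa [h] using EReal.coe_ennreal_nonneg (ENNReal.ofReal g)
      simp [hg]
    · rw [EReal.coe_mul_top_of_pos hc, EReal.top_add_coe, EReal.coe_ennreal_eq_top_iff] at h
      simp [h, hc]
  | coe v =>
    have hu : u ≠ ⊤ := by
      rintro rfl
      exact EReal.coe_ne_top (c * v + g) (by exact_mod_cast h.symm)
    rw [coe_eq_coe_mul_add_coe_iff hu ENNReal.coe_ne_top] at h
    rw [← ENNReal.toReal_eq_toReal_iff' (by finiteness) (by finiteness),
      ENNReal.toReal_add (by finiteness) (by finiteness),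
      ENNReal.toReal_add (by finiteness) (by finiteness),
      ENNReal.toReal_add (by finiteness) (by finiteness), ENNReal.toReal_mul, ENNReal.toReal_mul,
      ENNReal.toReal_ofReal', ENNReal.toReal_ofReal', ENNReal.toReal_ofReal',
      ENNReal.toReal_ofReal', h]
    linear_combination (-(v : ℝ≥0∞).toReal) * max_zero_sub_eq_self c - max_zero_sub_eq_self g

variable {μ : Measure X} {α : ℝ} {P Q R : Measure X} {c : ℝ} {g : X → ℝ} {N : Set X}

theorem lintegral_ofReal_eq_lintegral_ofReal_neg (hg : Integrable g P) (hg₀ : ∫ x, g x ∂P = 0) :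
    ∫⁻ x, ENNReal.ofReal (g x) ∂P = ∫⁻ x, ENNReal.ofReal (-g x) ∂P := by
  rw [integral_eq_lintegral_pos_part_sub_lintegral_neg_part hg, sub_eq_zero] at hg₀
  exact (ENNReal.toReal_eq_toReal_iff' hg.lintegral_lt_top.ne
    hg.neg.lintegral_lt_top.ne).1 hg₀

theorem crossMass_add_ofReal_neg_mul_crossMass (hg : Integrable g P) (hg₀ : ∫ x, g x ∂P = 0)
    (hlaw : ∀ᵐ x ∂P, ((Q.rnDeriv μ x ^ (α - 1) : ℝ≥0∞) : EReal) =
      (c : EReal) * ((R.rnDeriv μ x ^ (α - 1) : ℝ≥0∞) : EReal) + (g x : EReal)) :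
    crossMass μ α Q P + ENNReal.ofReal (-c) * crossMass μ α R P =
      ENNReal.ofReal c * crossMass μ α R P := by
  have hint := lintegral_congr_ae
    (hlaw.mono fun x hx => add_ofReal_neg_mul_add_ofReal_neg_eq hx)
  have hg_meas := hg.aestronglyMeasurable.aemeasurable
  rw [lintegral_add_right' (g := fun x => ENNReal.ofReal (-g x)) _ hg_meas.neg.ennreal_ofReal,
    lintegral_add_left ((Q.measurable_rnDeriv μ).pow_const _),
    lintegral_add_right' _ hg_meas.ennreal_ofReal, lintegral_const_mul _ (by fun_prop),
    lintegral_const_mul _ (by fun_prop), lintegral_ofReal_eq_lintegral_ofReal_neg hg hg₀] at hint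
  exact (ENNReal.add_left_inj hg.neg.lintegral_lt_top.ne).1 hint

theorem HasPowerLaw.ae_eq_of_measure_eq_zero {E : Set (Measure X)}
    (h : HasPowerLaw μ α E R Q c g N) (hac : P ≪ μ) (hPN : P N = 0) :
    ∀ᵐ x ∂P, ((Q.rnDeriv μ x ^ (α - 1) : ℝ≥0∞) : EReal) =
      (c : EReal) * ((R.rnDeriv μ x ^ (α - 1) : ℝ≥0∞) : EReal) + (g x : EReal) := by
  filter_upwards [hac.ae_le h.density_off, measure_eq_zero_iff_ae_notMem.1 hPN] with x hx hxN
  exact hx hxN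

variable [SigmaFinite μ]

theorem HasPowerLaw.measure_N_eq_zero [SigmaFinite Q] {E : Set (Measure X)}
    (h : HasPowerLaw μ α E R Q c g N) (hac : Q ≪ μ) : Q N = 0 := by
  rw [measure_eq_zero_iff_ae_notMem]
  filter_upwards [hac.ae_le h.density_on, Measure.rnDeriv_pos hac] with x hx hpos hxN
  exact hpos.ne' (hx hxN)

theorem HasPowerLaw.pos_and_powMass_eq (hα : 0 < α) {E : Set (Measure X)}
    (h : HasPowerLaw μ α E R Q c g N) (hQ : Admissible μ α Q) (hg : Integrable g Q)
    (hg₀ : ∫ x, g x ∂Q = 0) :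
    0 < c ∧ powMass μ α Q = ENNReal.ofReal c * crossMass μ α R Q := by
  have := hQ.isProb
  have heq := crossMass_add_ofReal_neg_mul_crossMass hg hg₀
    (h.ae_eq_of_measure_eq_zero hQ.ac (h.measure_N_eq_zero hQ.ac))
  rw [crossMass_self hα hQ.ac] at heq
  have hc : 0 < c := by
    by_contra! hc
    rw [ENNReal.ofReal_of_nonpos hc, zero_mul] at heq
    exact hQ.powMass_ne_zero hα (add_eq_zero.1 heq).1
  rw [ENNReal.ofReal_of_nonpos (neg_nonpos.2 hc.le), zero_mul, add_zero] at heq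
  exact ⟨hc, heq⟩

end PowerLaw

section SideInequality

variable {μ : Measure X} {α : ℝ} {P Q R Z : Measure X} {c : ℝ} {g : X → ℝ} {N : Set X}

theorem integrable_rpow_of_crossMass_ne_top (h : crossMass μ α Z P ≠ ⊤) :
    Integrable (fun x => (Z.rnDeriv μ x).toReal ^ (α - 1)) P := by
  simp only [ENNReal.toReal_rpow]
  exact integrable_toReal_of_lintegral_ne_top
    ((Z.measurable_rnDeriv μ).pow_const _).aemeasurable h

theorem integral_rpow_eq_toReal_crossMass (h : crossMass μ α Z P ≠ ⊤) :
    ∫ x, (Z.rnDeriv μ x).toReal ^ (α - 1) ∂P = (crossMass μ α Z P).toReal := by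
  have hmeas := (Z.measurable_rnDeriv μ).pow_const (α - 1)
  simp only [ENNReal.toReal_rpow]
  exact integral_toReal hmeas.aemeasurable (ae_lt_top hmeas h)

theorem sideIneq_iff_mul_crossMass_le (hP : P ≪ μ) (hRP : crossMass μ α R P ≠ ⊤)
    (hQP : crossMass μ α Q P ≠ ⊤) (hN : MeasurableSet N)
    (hoff : ∀ᵐ x ∂μ, x ∉ N → ((Q.rnDeriv μ x ^ (α - 1) : ℝ≥0∞) : EReal) =
      (c : EReal) * ((R.rnDeriv μ x ^ (α - 1) : ℝ≥0∞) : EReal) + (g x : EReal)) :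
    SideIneq μ α R c g N P ↔
      c * (crossMass μ α R P).toReal ≤ ∫ x in Nᶜ, (Q.rnDeriv μ x).toReal ^ (α - 1) ∂P := by
  have hr := integrable_rpow_of_crossMass_ne_top hRP
  have hq := integrable_rpow_of_crossMass_ne_top hQP
  have hg : ∫ x in Nᶜ, g x ∂P = ∫ x in Nᶜ, ((Q.rnDeriv μ x).toReal ^ (α - 1) -
      c * (R.rnDeriv μ x).toReal ^ (α - 1)) ∂P := by
    refine setIntegral_congr_ae hN.compl ?_
    filter_upwards [hP.ae_le hoff, ae_lt_top ((Q.measurable_rnDeriv μ).pow_const _) hQP,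
      ae_lt_top ((R.measurable_rnDeriv μ).pow_const _) hRP] with x hx hqx hrx hxN
    rw [ENNReal.toReal_rpow, ENNReal.toReal_rpow,
      (coe_eq_coe_mul_add_coe_iff hqx.ne hrx.ne).1 (hx hxN), add_sub_cancel_left]
  rw [SideIneq, hg, integral_sub hq.integrableOn (hr.integrableOn.const_mul c),
    integral_const_mul, ← integral_rpow_eq_toReal_crossMass hRP, ← integral_add_compl hN hr]
  constructor <;> intro h <;> linarith

theorem sideIneq_iff (hN : MeasurableSet N) (hRP : crossMass μ α R P ≠ ⊤) (hg : Integrable g P)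
    (hg₀ : ∫ x, g x ∂P = 0) :
    SideIneq μ α R c g N P ↔
      ∫ x in N, (c * (R.rnDeriv μ x).toReal ^ (α - 1) + g x) ∂P ≤ 0 := by
  have hr := integrable_rpow_of_crossMass_ne_top hRP
  rw [← integral_add_compl hN hg] at hg₀
  rw [integral_add (hr.integrableOn.const_mul c) hg.integrableOn, integral_const_mul, SideIneq]
  constructor <;> intro h <;> linarith

end SideInequality

section Sufficiency

variable {μ : Measure X} [SigmaFinite μ] {α : ℝ} {Γ : Type*} {f : Γ → X → ℝ} {Q R : Measure X}
  {c : ℝ} {g : X → ℝ} {N : Set X}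

theorem HasPowerLaw.isForwardProjection_of_lt_one (hα : 0 < α) (hα₁ : α < 1)
    (hR : Admissible μ α R) (hQ : Q ∈ linearFamily μ α f) (hg : g ∈ constraintSpan f)
    (h : HasPowerLaw μ α (linearFamily μ α f) R Q c g N) :
    IsForwardProjection μ α (linearFamily μ α f) R Q := by
  have hg_int : ∀ P ∈ linearFamily μ α f, Integrable g P := fun P hP =>
    integrable_of_mem_constraintSpan (fun γ => (hP.2 γ).1) hg
  have hg_zero : ∀ P ∈ linearFamily μ α f, ∫ x, g x ∂P = 0 := fun P hP =>
    integral_eq_zero_of_mem_constraintSpan (fun γ => (hP.2 γ).1) (fun γ => (hP.2 γ).2) hg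
  obtain ⟨hc, hpow⟩ := h.pos_and_powMass_eq hα hQ.1 (hg_int Q hQ) (hg_zero Q hQ)
  have hRQ : crossMass μ α R Q ≠ ⊤ := fun htop => hQ.1.powMass_ne_top hα <| by
    rw [hpow, htop, ENNReal.mul_top (ENNReal.ofReal_pos.2 hc).ne']
  refine (isForwardProjection_iff hQ).2
    ⟨(relEntropy_lt_top_iff_of_lt_one hα hα₁ hQ.1 hR).2 hRQ, fun P hP => ?_⟩
  rcases eq_or_ne (relEntropy μ α P R) ⊤ with htop | hfin
  · exact htop ▸ le_top
  have hlaw := crossMass_add_ofReal_neg_mul_crossMass (hg_int P hP) (hg_zero P hP)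
    (h.ae_eq_of_measure_eq_zero hP.1.ac (h.side_lt_one hα₁ P ⟨hP, hP.1, hfin.lt_top⟩))
  rw [ENNReal.ofReal_of_nonpos (neg_nonpos.2 hc.le), zero_mul, add_zero] at hlaw
  refine relEntropy_le_of_variation_of_lt_one hα hα₁ hP.1 hQ.1 hR (le_of_eq ?_)
  rw [hlaw, hpow]
  ring

theorem HasPowerLaw.isForwardProjection_of_one_lt (hα₁ : 1 < α)
    (hR : Admissible μ α R) (hQ : Q ∈ linearFamily μ α f) (hg : g ∈ constraintSpan f)
    (h : HasPowerLaw μ α (linearFamily μ α f) R Q c g N) :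
    IsForwardProjection μ α (linearFamily μ α f) R Q := by
  have hα := zero_lt_one.trans hα₁
  obtain ⟨hc, hpow⟩ := h.pos_and_powMass_eq hα hQ.1
    (integrable_of_mem_constraintSpan (fun γ => (hQ.2 γ).1) hg)
    (integral_eq_zero_of_mem_constraintSpan (fun γ => (hQ.2 γ).1) (fun γ => (hQ.2 γ).2) hg)
  have hRQ : crossMass μ α R Q ≠ 0 := fun hzero => hQ.1.powMass_ne_zero hα <| by
    rw [hpow, hzero, mul_zero]
  refine (isForwardProjection_iff hQ).2
    ⟨(relEntropy_lt_top_iff_of_one_lt hα₁ hQ.1 hR).2 hRQ, fun P hP => ?_⟩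
  rcases eq_or_ne (relEntropy μ α P R) ⊤ with htop | hfin
  · exact htop ▸ le_top
  have hRP := hP.1.crossMass_ne_top hα₁ hR
  have hQP := hP.1.crossMass_ne_top hα₁ hQ.1
  have hside : ENNReal.ofReal c * crossMass μ α R P ≤ crossMass μ α Q P := by
    rw [← ENNReal.toReal_le_toReal (ENNReal.mul_ne_top ENNReal.ofReal_ne_top hRP) hQP,
      ENNReal.toReal_mul, ENNReal.toReal_ofReal hc.le, ← integral_rpow_eq_toReal_crossMass hQP]
    exact ((sideIneq_iff_mul_crossMass_le hP.1.ac hRP hQP h.measurable_N h.density_off).1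
      (h.side_one_lt hα₁ P ⟨hP, hP.1, hfin.lt_top⟩)).trans
      (setIntegral_le_integral (integrable_rpow_of_crossMass_ne_top hQP)
        (ae_of_all _ fun x => Real.rpow_nonneg ENNReal.toReal_nonneg _))
  refine relEntropy_le_of_variation_of_one_lt hα₁ hP.1 hQ.1 hR ?_
  calc crossMass μ α R P * powMass μ α Q
      = crossMass μ α R Q * (ENNReal.ofReal c * crossMass μ α R P) := by rw [hpow]; ring
    _ ≤ crossMass μ α R Q * crossMass μ α Q P := by gcongr

end Sufficiency

section Reweighting

variable {Q : Measure X} {w : X → ℝ} {B : ℝ}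

theorem integral_withDensity_ofReal (hw : Measurable w) (hw₀ : ∀ x, 0 ≤ w x) (v : X → ℝ) :
    ∫ x, v x ∂(Q.withDensity fun x => ENNReal.ofReal (w x)) = ∫ x, w x * v x ∂Q := by
  rw [integral_withDensity_eq_integral_toReal_smul hw.ennreal_ofReal
    (ae_of_all _ fun _ => ENNReal.ofReal_lt_top)]
  simp only [ENNReal.toReal_ofReal (hw₀ _), smul_eq_mul]

theorem withDensity_ofReal_le_smul (hwB : ∀ x, w x ≤ B) :
    (Q.withDensity fun x => ENNReal.ofReal (w x)) ≤ ENNReal.ofReal B • Q := by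
  rw [← withDensity_const]
  exact withDensity_mono (ae_of_all _ fun x => ENNReal.ofReal_le_ofReal (hwB x))

theorem integrable_withDensity_ofReal (hwB : ∀ x, w x ≤ B) {v : X → ℝ} (hv : Integrable v Q) :
    Integrable v (Q.withDensity fun x => ENNReal.ofReal (w x)) :=
  (hv.smul_measure ENNReal.ofReal_ne_top).mono_measure (withDensity_ofReal_le_smul hwB)

theorem crossMass_withDensity_ofReal_ne_top {μ : Measure X} {α : ℝ} {Z : Measure X}
    (hwB : ∀ x, w x ≤ B) (h : crossMass μ α Z Q ≠ ⊤) :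
    crossMass μ α Z (Q.withDensity fun x => ENNReal.ofReal (w x)) ≠ ⊤ := by
  refine ne_top_of_le_ne_top (ENNReal.mul_ne_top (ENNReal.ofReal_ne_top (r := B)) h)
    ((lintegral_mono' (withDensity_ofReal_le_smul hwB) le_rfl).trans_eq ?_)
  rw [lintegral_smul_measure, smul_eq_mul, crossMass]

variable {μ : Measure X} [SigmaFinite μ] {α : ℝ}

theorem powMass_withDensity_ofReal_ne_top (hα : 0 < α) (hQ : Admissible μ α Q)
    (hw : Measurable w) (hwB : ∀ x, w x ≤ B) :
    powMass μ α (Q.withDensity fun x => ENNReal.ofReal (w x)) ≠ ⊤ := by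
  have := hQ.isProb
  refine ne_top_of_le_ne_top (ENNReal.mul_ne_top (ENNReal.rpow_ne_top_of_nonneg hα.le
    (ENNReal.ofReal_ne_top (r := B))) (hQ.powMass_ne_top hα)) ?_
  rw [powMass, powMass, ← lintegral_const_mul _ ((Q.measurable_rnDeriv μ).pow_const α)]
  refine lintegral_mono_ae ?_
  filter_upwards [Measure.rnDeriv_withDensity_left_of_absolutelyContinuous hQ.ac
    hw.ennreal_ofReal.aemeasurable] with x hx
  rw [hx, ENNReal.mul_rpow_of_nonneg _ _ hα.le]
  gcongr
  exact hwB x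

theorem withDensity_ofReal_mem_linearFamily (hα : 0 < α) {Γ : Type*} {f : Γ → X → ℝ}
    (hQ : Q ∈ linearFamily μ α f) (hw : Measurable w) (hw₀ : ∀ x, 0 ≤ w x)
    (hwB : ∀ x, w x ≤ B) (hw₁ : ∫ x, w x ∂Q = 1) (hwf : ∀ γ, ∫ x, w x * f γ x ∂Q = 0) :
    (Q.withDensity fun x => ENNReal.ofReal (w x)) ∈ linearFamily μ α f := by
  have := hQ.1.isProb
  have hw_int : Integrable w Q := Integrable.of_bound hw.aestronglyMeasurable B
    (ae_of_all _ fun x => by rw [Real.norm_of_nonneg (hw₀ x)]; exact hwB x)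
  have hprob : IsProbabilityMeasure (Q.withDensity fun x => ENNReal.ofReal (w x)) := by
    constructor
    rw [withDensity_apply _ MeasurableSet.univ, Measure.restrict_univ,
      ← ofReal_integral_eq_lintegral_ofReal hw_int (ae_of_all _ hw₀), hw₁, ENNReal.ofReal_one]
  refine ⟨admissible_of_powMass_ne_top hα hprob
    ((withDensity_absolutelyContinuous _ _).trans hQ.1.ac)
    (powMass_withDensity_ofReal_ne_top hα hQ.1 hw hwB), fun γ =>
      ⟨integrable_withDensity_ofReal hwB (hQ.2 γ).1, ?_⟩⟩
  rw [integral_withDensity_ofReal hw hw₀, hwf γ]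

end Reweighting

section Necessity

variable {μ : Measure X} [SigmaFinite μ] {α : ℝ} {Γ : Type*} {f : Γ → X → ℝ} {Q R : Measure X}

-- At a projection, `hvar` holds with `s = 1` if `α < 1`, and with `s = -1` if `α > 1`.
theorem exists_mem_constraintSpan_of_variation (hα : 0 < α) (hQ : Q ∈ linearFamily μ α f)
    (hcl : SpanClosedL1 f Q) (hRQ : crossMass μ α R Q ≠ ⊤) {s : ℝ}
    (hvar : ∀ P ∈ linearFamily μ α f, crossMass μ α R P ≠ ⊤ → crossMass μ α Q P ≠ ⊤ →
      s * ((crossMass μ α R Q).toReal * (crossMass μ α Q P).toReal -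
        (powMass μ α Q).toReal * (crossMass μ α R P).toReal) ≤ 0) :
    ∃ g ∈ constraintSpan f, ∀ᵐ x ∂Q,
      s * ((crossMass μ α R Q).toReal * (Q.rnDeriv μ x).toReal ^ (α - 1) -
        (powMass μ α Q).toReal * (R.rnDeriv μ x).toReal ^ (α - 1)) = g x := by
  have := hQ.1.isProb
  have hself := crossMass_self hα hQ.1.ac
  have hQQ : crossMass μ α Q Q ≠ ⊤ := hself ▸ hQ.1.powMass_ne_top hα
  set a := (crossMass μ α R Q).toReal
  set M := (powMass μ α Q).toReal
  have hint : ∀ P : Measure X, crossMass μ α R P ≠ ⊤ → crossMass μ α Q P ≠ ⊤ →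
      ∫ x, s * (a * (Q.rnDeriv μ x).toReal ^ (α - 1) -
        M * (R.rnDeriv μ x).toReal ^ (α - 1)) ∂P =
      s * (a * (crossMass μ α Q P).toReal - M * (crossMass μ α R P).toReal) := by
    intro P hRP hQP
    rw [integral_const_mul, integral_sub ((integrable_rpow_of_crossMass_ne_top hQP).const_mul a)
      ((integrable_rpow_of_crossMass_ne_top hRP).const_mul M), integral_const_mul,
      integral_const_mul, integral_rpow_eq_toReal_crossMass hQP,
      integral_rpow_eq_toReal_crossMass hRP]
  refine exists_mem_constraintSpan_of_reweighting (fun γ => (hQ.2 γ).1) (fun γ => (hQ.2 γ).2) hcl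
    ((((integrable_rpow_of_crossMass_ne_top hQQ).const_mul a).sub
      ((integrable_rpow_of_crossMass_ne_top hRQ).const_mul M)).const_mul s) ?_ ?_
  · rw [hint Q hRQ hQQ, hself, mul_comm a, sub_self, mul_zero]
  · intro w hw hw₀ hw₂ hw₁ hwf
    have hRP := crossMass_withDensity_ofReal_ne_top hw₂ hRQ
    have hQP := crossMass_withDensity_ofReal_ne_top hw₂ hQQ
    rw [← integral_withDensity_ofReal hw hw₀, hint _ hRP hQP]
    exact hvar _ (withDensity_ofReal_mem_linearFamily hα hQ hw hw₀ hw₂ hw₁ hwf) hRP hQP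

theorem exists_density_eq_of_variation (hα : 0 < α) (hQ : Q ∈ linearFamily μ α f)
    (hcl : SpanClosedL1 f Q) (hRQ₀ : crossMass μ α R Q ≠ 0) (hRQ : crossMass μ α R Q ≠ ⊤)
    {s : ℝ} (hs : s ≠ 0)
    (hvar : ∀ P ∈ linearFamily μ α f, crossMass μ α R P ≠ ⊤ → crossMass μ α Q P ≠ ⊤ →
      s * ((crossMass μ α R Q).toReal * (crossMass μ α Q P).toReal -
        (powMass μ α Q).toReal * (crossMass μ α R P).toReal) ≤ 0) :
    ∃ g ∈ constraintSpan f, ∀ᵐ x ∂μ, Q.rnDeriv μ x ≠ 0 →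
      ((Q.rnDeriv μ x ^ (α - 1) : ℝ≥0∞) : EReal) =
        (((powMass μ α Q).toReal / (crossMass μ α R Q).toReal : ℝ) : EReal) *
          ((R.rnDeriv μ x ^ (α - 1) : ℝ≥0∞) : EReal) + (g x : EReal) := by
  have := hQ.1.isProb
  have hQQ : crossMass μ α Q Q ≠ ⊤ := crossMass_self hα hQ.1.ac ▸ hQ.1.powMass_ne_top hα
  have ha : (crossMass μ α R Q).toReal ≠ 0 := (ENNReal.toReal_pos hRQ₀ hRQ).ne'
  obtain ⟨g, hg, hgu⟩ := exists_mem_constraintSpan_of_variation hα hQ hcl hRQ hvar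
  refine ⟨(s * (crossMass μ α R Q).toReal)⁻¹ • g, Submodule.smul_mem _ _ hg,
    (ae_iff_forall_ae_rnDeriv_ne_zero hQ.1.ac).1 ?_⟩
  filter_upwards [hgu, ae_lt_top ((Q.measurable_rnDeriv μ).pow_const _) hQQ,
    ae_lt_top ((R.measurable_rnDeriv μ).pow_const _) hRQ] with x hx hqx hrx
  rw [coe_eq_coe_mul_add_coe_iff hqx.ne hrx.ne, Pi.smul_apply, ← hx, smul_eq_mul,
    ENNReal.toReal_rpow, ENNReal.toReal_rpow]
  field_simp
  ring

theorem exists_hasPowerLaw_of_lt_one (hα : 0 < α) (hα₁ : α < 1) (hR : Admissible μ α R)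
    (hQ : Q ∈ linearFamily μ α f) (hcl : SpanClosedL1 f Q)
    (h : IsForwardProjection μ α (linearFamily μ α f) R Q) :
    ∃ c : ℝ, ∃ g ∈ constraintSpan f, ∃ N : Set X,
      HasPowerLaw μ α (linearFamily μ α f) R Q c g N := by
  obtain ⟨hfin, hle⟩ := (isForwardProjection_iff hQ).1 h
  have hRQ := (relEntropy_lt_top_iff_of_lt_one hα hα₁ hQ.1 hR).1 hfin
  have hRQ₀ : crossMass μ α R Q ≠ 0 := ne_bot_of_le_ne_bot (mul_ne_zero
    (hQ.1.powMass_rpow_ne_zero hα _) (hR.powMass_rpow_ne_zero hα _))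
    (powMass_rpow_mul_le_crossMass hα hα₁ hQ.1 hR)
  have hvar : ∀ P ∈ linearFamily μ α f,
      crossMass μ α R Q * crossMass μ α Q P ≤ crossMass μ α R P * powMass μ α Q := fun P hP =>
    crossMass_mul_crossMass_le_of_forall_mix hα hα₁ hP.1 hQ.1 hR hRQ fun t ht =>
      hle _ (mix_mem_linearFamily hα ht.2.le hQ hP)
  obtain ⟨g, hg, hlaw⟩ := exists_density_eq_of_variation hα hQ hcl hRQ₀ hRQ one_ne_zero
    fun P hP hRP _ => by
      have hreal := ENNReal.toReal_mono
        (ENNReal.mul_ne_top hRP (hQ.1.powMass_ne_top hα)) (hvar P hP)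
      rw [ENNReal.toReal_mul, ENNReal.toReal_mul] at hreal
      linarith
  refine ⟨_, g, hg, {x | Q.rnDeriv μ x = 0},
    measurableSet_eq_fun (Q.measurable_rnDeriv μ) measurable_const, hlaw,
    ae_of_all _ fun _ hx => hx, fun _ P hP => ?_, fun hα₂ => absurd hα₂ hα₁.not_gt⟩
  have hRP := (relEntropy_lt_top_iff_of_lt_one hα hα₁ hP.2.1 hR).1 hP.2.2
  have hQP : crossMass μ α Q P ≠ ⊤ := fun htop => by
    have hbound := hvar P hP.1
    rw [htop, ENNReal.mul_top hRQ₀, top_le_iff] at hbound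
    exact ENNReal.mul_ne_top hRP (hQ.1.powMass_ne_top hα) hbound
  exact measure_eq_zero_iff_ae_notMem.2 (ae_ne_zero_of_crossMass_ne_top hα₁ hQP)

theorem exists_hasPowerLaw_of_one_lt (hα₁ : 1 < α) (hR : Admissible μ α R)
    (hQ : Q ∈ linearFamily μ α f) (hcl : SpanClosedL1 f Q)
    (h : IsForwardProjection μ α (linearFamily μ α f) R Q) :
    ∃ c : ℝ, ∃ g ∈ constraintSpan f, ∃ N : Set X,
      HasPowerLaw μ α (linearFamily μ α f) R Q c g N := by
  have hα := zero_lt_one.trans hα₁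
  obtain ⟨hfin, hle⟩ := (isForwardProjection_iff hQ).1 h
  have hRQ₀ := (relEntropy_lt_top_iff_of_one_lt hα₁ hQ.1 hR).1 hfin
  have hRQ := hQ.1.crossMass_ne_top hα₁ hR
  have hvar : ∀ P ∈ linearFamily μ α f,
      (powMass μ α Q).toReal * (crossMass μ α R P).toReal ≤
        (crossMass μ α R Q).toReal * (crossMass μ α Q P).toReal := fun P hP => by
    rw [mul_comm, ← ENNReal.toReal_mul, ← ENNReal.toReal_mul]
    exact ENNReal.toReal_mono (ENNReal.mul_ne_top hRQ (hP.1.crossMass_ne_top hα₁ hQ.1))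
      (crossMass_mul_powMass_le_of_forall_mix hα₁ hP.1 hQ.1 hR fun t ht =>
        hle _ (mix_mem_linearFamily hα ht.2.le hQ hP))
  obtain ⟨g, hg, hlaw⟩ := exists_density_eq_of_variation hα hQ hcl hRQ₀ hRQ
    (neg_ne_zero.2 one_ne_zero) fun P hP _ _ => by linarith [hvar P hP]
  have hN : MeasurableSet {x | Q.rnDeriv μ x = 0} :=
    measurableSet_eq_fun (Q.measurable_rnDeriv μ) measurable_const
  refine ⟨_, g, hg, {x | Q.rnDeriv μ x = 0}, hN, hlaw, ae_of_all _ fun _ hx => hx,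
    fun hα₂ => absurd hα₂ hα₁.not_gt, fun _ P hP => ?_⟩
  have hQP := hP.2.1.crossMass_ne_top hα₁ hQ.1
  have hcompl : ∫ x in {x | Q.rnDeriv μ x = 0}ᶜ, (Q.rnDeriv μ x).toReal ^ (α - 1) ∂P =
      (crossMass μ α Q P).toReal := by
    rw [← integral_rpow_eq_toReal_crossMass hQP]
    refine setIntegral_eq_integral_of_forall_compl_eq_zero fun x hx => ?_
    rw [Set.notMem_compl_iff.1 hx, ENNReal.toReal_zero, Real.zero_rpow (sub_pos.2 hα₁).ne']
  rw [sideIneq_iff_mul_crossMass_le hP.2.1.ac (hP.2.1.crossMass_ne_top hα₁ hR) hQP hN hlaw, hcompl,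
    div_mul_eq_mul_div, div_le_iff₀' (ENNReal.toReal_pos hRQ₀ hRQ)]
  exact hvar P hP.1

end Necessity

end RelAlpha

end

theorem mainTheorem5_general {X : Type*} [MeasurableSpace X] (μ : MeasureTheory.Measure X)
    [MeasureTheory.SigmaFinite μ] (α : ℝ) (hα : 0 < α) (hα1 : α ≠ 1)
    {Γ : Type*} (f : Γ → X → ℝ) (R : MeasureTheory.Measure X) (hR : RelAlpha.Admissible μ α R) :
    (Finite Γ → ∀ P ∈ RelAlpha.linearFamily μ α f, RelAlpha.SpanClosedL1 f P) ∧
    (∀ Q ∈ RelAlpha.linearFamily μ α f, RelAlpha.SpanClosedL1 f Q →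
      (RelAlpha.IsForwardProjection μ α (RelAlpha.linearFamily μ α f) R Q ↔
        ∃ c : ℝ, ∃ g ∈ RelAlpha.constraintSpan f, ∃ N : Set X,
          RelAlpha.HasPowerLaw μ α (RelAlpha.linearFamily μ α f) R Q c g N)) ∧
    (1 < α → ∀ (c : ℝ), ∀ g ∈ RelAlpha.constraintSpan f, ∀ N : Set X, MeasurableSet N →
      ∀ P ∈ RelAlpha.linearFamily μ α f,
        (RelAlpha.SideIneq μ α R c g N P ↔
          ∫ x in N, (c * (R.rnDeriv μ x).toReal ^ (α - 1) + g x) ∂P ≤ 0)) := by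
  refine ⟨fun _ P hP => RelAlpha.spanClosedL1_of_finite fun γ => (hP.2 γ).1,
    fun Q hQ hcl => ⟨fun h => ?_, fun ⟨c, g, hg, N, h⟩ => ?_⟩, fun h₁ c g hg N hN P hP => ?_⟩
  · rcases hα1.lt_or_gt with h₁ | h₁
    · exact RelAlpha.exists_hasPowerLaw_of_lt_one hα h₁ hR hQ hcl h
    · exact RelAlpha.exists_hasPowerLaw_of_one_lt h₁ hR hQ hcl h
  · rcases hα1.lt_or_gt with h₁ | h₁
    · exact h.isForwardProjection_of_lt_one hα h₁ hR hQ hg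
    · exact h.isForwardProjection_of_one_lt h₁ hR hQ hg
  · have hf : ∀ γ, Integrable (f γ) P := fun γ => (hP.2 γ).1
    exact RelAlpha.sideIneq_iff hN (hP.1.crossMass_ne_top h₁ hR)
      (RelAlpha.integrable_of_mem_constraintSpan hf hg)
      (RelAlpha.integral_eq_zero_of_mem_constraintSpan hf (fun γ => (hP.2 γ).2) hg)

theorem mainTheorem5 {X : Type*} [MeasurableSpace X] (μ : MeasureTheory.Measure X)
    [MeasureTheory.SigmaFinite μ] (α : ℝ) (hα : 0 < α) (hα1 : α ≠ 1)
    {Γ : Type*} (f : Γ → X → ℝ) (hf : ∀ γ, Measurable (f γ))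
    (R : MeasureTheory.Measure X) (hR : RelAlpha.Admissible μ α R) :
    (Finite Γ → ∀ P ∈ RelAlpha.linearFamily μ α f, RelAlpha.SpanClosedL1 f P) ∧
    ((∀ P ∈ RelAlpha.linearFamily μ α f, RelAlpha.SpanClosedL1 f P) →
      (∀ Q ∈ RelAlpha.linearFamily μ α f,
        (RelAlpha.IsForwardProjection μ α (RelAlpha.linearFamily μ α f) R Q ↔
          ∃ c : ℝ, ∃ g ∈ RelAlpha.constraintSpan f, ∃ N : Set X,
            RelAlpha.HasPowerLaw μ α (RelAlpha.linearFamily μ α f) R Q c g N)) ∧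
      (1 < α → ∀ (c : ℝ), ∀ g ∈ RelAlpha.constraintSpan f, ∀ N : Set X, MeasurableSet N →
        ∀ P ∈ RelAlpha.linearFamily μ α f,
          (RelAlpha.SideIneq μ α R c g N P ↔
            ∫ x in N, (c * (R.rnDeriv μ x).toReal ^ (α - 1) + g x) ∂P ≤ 0))) := by
  obtain ⟨hfin, hproj, hside⟩ := mainTheorem5_general μ α hα hα1 f R hR
  exact ⟨hfin, fun hcl => ⟨fun Q hQ => hproj Q hQ (hcl Q hQ), hside⟩⟩
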